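/- Let $\mathcal H$ be an infinite-dimensional separable real Hilbert space, $\|\cdot\|_{\mathcal L}$ and $\|\cdot\|_{\mathcal S}$ the operator and Hilbert–Schmidt norms, $x\otimes y:=\langle x,\cdot\rangle y$, and $\mathscr C_{U,V}:=\mathbb E[(U-\mathbb EU)\otimes(V-\mathbb EV)]$, $\mathscr C_U:=\mathscr C_{U,U}$. Let $(\varepsilon_k)_{k\in\mathbb Z}$ be a strictly stationary, ergodic $\mathcal H$-valued white noise (centered, weakly stationary, $\mathbb E\|\varepsilon_k\|^2>0$, $\mathscr C_{\varepsilon_k,\varepsilon_l}=0$ for $k\ne l$) with $\mathbb E\|\varepsilon_k\|^4<\infty$ and injective covariance operator. Let $(X_k)_{k\in\mathbb Z}$ be a centered, strictly stationary, square-integrable fMA$(q)$ process, $q\ge1$, $$X_k=\varepsilon_k+\sum_{j=1}^q\beta_j(\varepsilon_{k-j})\ \text{a.s.},\qquad \beta_j\in\mathcal L_{\mathcal H},\ \beta_q\neq0,$$ that is invertible: $X_k=\sum_{j\ge1}\psi_j(X_{k-j})+\varepsilon_k$ a.s., where the $\psi_j$ are Hilbert–Schmidt operators with $\sum_j\|\psi_j\|_{\mathcal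 S}^2<\infty$ and $\sum_j\|\psi_j\|_{\mathcal L}<\infty$. For $L\ge1$ put $X^{[L]}_k=(X_k,\dots,X_{k-L+1})\in\mathcal H^L$, $\Psi_L=(\psi_1\cdots\psi_L):\mathcal H^L\to\mathcal H$, $\mathscr C_L=\mathscr C_{X_0^{[L]}}$, $\mathscr D_L=\mathscr C_{X_0^{[L]},X_1}$, and, from the sample $X_1,\dots,X_N$, $$\hat{\mathscr C}_L=\frac1{N-L+1}\sum_{k=L}^NX_k^{[L]}\otimes X_k^{[L]},\qquad \hat{\mathscr D}_L=\frac1{N-L}\sum_{k=L}^{N-1}X_k^{[L]}\otimes X_{k+1}.$$ Let $L=L_N\to\infty$ with $L=o(N^{1/3})$ and $$\|\hat{\mathscr C}_L-\mathscr C_L\|_{\mathcal S}=O_{\mathbb P}(L^{3/2}N^{-1/2}),\qquad \|\hat{\mathscr D}_L-\mathscr D_L\|_{\mathcal S}=O_{\mathbb P}(LN^{-1/2}).$$ Let $(\lambda_j,c_j)_{j\ge1}$ (depending on $L=L_N$), $(\nu_j,d_j)_{j\ge1}$ and $(\hat\lambda_j,\hat c_j)_{j\ge1}$ be the eigenpairs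 of $\mathscr C_L$, $\mathscr C_{X_0}$ and $\hat{\mathscr C}_L$, with eigenvalues in decreasing order and eigenvectors forming complete orthonormal systems, and suppose $\lambda_j\ne\lambda_{j+1}$ for all $j$ and $L=L_N$. Put $\Lambda_k=\sup_{1\le j\le k}(\lambda_j-\lambda_{j+1})^{-1}$. Let $\beta>0$ be such that for every $L=L_N$ $$S_{\Psi_L}(\beta)=\sum_{i,j\ge1}\langle\Psi_L,c_i\otimes d_j\rangle_{\mathcal S}^2(1+i^{2\beta}+j^{2\beta})<\infty .$$ Let $K=K_N\to\infty$ be positive integers and $\theta_N>0$, $\theta_N\to0$, with $\theta_N=o(\lambda_K)$ and $$K^{1+\beta}\lambda_K^{-1}\Lambda_KL^2=O(N^{1/2}),\quad \sum_{\ell>L}\|\psi_\ell\|_{\mathcal L}=o(K\Lambda_KL^{3/2}N^{-1/2}),\quad \theta_N=o(K\Lambda_KL^2N^{-1/2}).$$ Define $\hat\Psi_L=\hat{\mathscr D}_L(\hat{\mathscr C}_L+\theta_N\mathbb I)^{-1}\coprod_{\hat c_1}^{\hat c_K}$, where $\coprod_{\hat c_1}^{\hat c_K}$ is the orthogonal projection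 onto $\mathrm{span}\{\hat c_1,\dots,\hat c_K\}$, let $\hat\psi_1,\dots,\hat\psi_L$ be the components of $\hat\Psi_L$, and let $\hat\beta_j:=\hat\phi_j$, where $\hat\phi_0=\mathbb I$ and $\hat\phi_i=\sum_{j=1}^i\hat\psi_j\hat\phi_{i-j}$. Then, as $N\to\infty$, for every $j=1,\dots,q$, $$\|\hat\beta_j-\beta_j\|_{\mathcal S}=O_{\mathbb P}\Big(K^{-\beta}\sqrt{1+S_{\Psi_{L_N}}(\beta)}\Big);$$ and if the limit $\lim_{N\to\infty}S_{\Psi_{L_N}}(\beta)<\infty$ exists, then for every $j=1,\dots,q$, $$\|\hat\beta_j-\beta_j\|_{\mathcal S}=O_{\mathbb P}(K^{-\beta}).$$ -/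

import Mathlib

open MeasureTheory Filter Topology Asymptotics
open scoped ENNReal

noncomputable section

namespace FMA

/-! ### Operators on Hilbert spaces -/

section Operators

variable {E F : Type*} [NormedAddCommGroup E] [InnerProductSpace ℝ E]
  [NormedAddCommGroup F] [InnerProductSpace ℝ F]

/-- The tensorial product `x ⊗ y = ⟨x, ·⟩ y`, a bounded operator `E → F`. -/
def tensor (x : E) (y : F) : E →L[ℝ] F := InnerProductSpace.rankOne ℝ y x

theorem tensor_apply (x : E) (y : F) (z : E) : tensor x y z = inner ℝ x z • y := rfl

/-- The Hilbert-Schmidt norm `(∑ᵢ ‖T eᵢ‖²)^{1/2}` along a complete orthonormal system `(eᵢ)` of `E`;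
it is `∞` if `T` is not a Hilbert-Schmidt operator. By `hsNorm_eq_of_basis` it does not
depend on the orthonormal system. -/
def hsNorm [CompleteSpace E] (T : E →L[ℝ] F) : ℝ≥0∞ :=
  (∑' i, ‖T ((exists_hilbertBasis ℝ E).choose_spec.choose i)‖ₑ ^ 2) ^ (1 / 2 : ℝ)

theorem enorm_sq_eq_tsum {ι : Type*} (b : HilbertBasis ι ℝ E) (x : E) :
    ‖x‖ₑ ^ 2 = ∑' i, ‖(inner ℝ x (b i) : ℝ)‖ₑ ^ 2 := by
  have h := b.hasSum_inner_mul_inner x x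
  have h2 : HasSum (fun i => ‖(inner ℝ x (b i) : ℝ)‖ ^ 2) (‖x‖ ^ 2) := by
    rw [real_inner_self_eq_norm_sq] at h
    refine h.congr_fun fun i => ?_
    rw [real_inner_comm x (b i), Real.norm_eq_abs, sq_abs, sq]
  have h3 := ENNReal.ofReal_tsum_of_nonneg (fun i => by positivity) h2.summable
  rw [h2.tsum_eq, ENNReal.ofReal_pow (norm_nonneg _), ofReal_norm] at h3
  rw [h3]
  refine tsum_congr fun i => ?_
  rw [ENNReal.ofReal_pow (norm_nonneg _), ofReal_norm]

theorem tsum_enorm_sq_adjoint [CompleteSpace E] [CompleteSpace F] {ι κ : Type*}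
    (b : HilbertBasis ι ℝ E) (d : HilbertBasis κ ℝ F) (T : E →L[ℝ] F) :
    ∑' i, ‖T (b i)‖ₑ ^ 2 = ∑' j, ‖ContinuousLinearMap.adjoint T (d j)‖ₑ ^ 2 := by
  simp_rw [enorm_sq_eq_tsum d (T _), enorm_sq_eq_tsum b (ContinuousLinearMap.adjoint T _)]
  rw [ENNReal.tsum_comm]
  refine tsum_congr fun j => tsum_congr fun i => ?_
  rw [ContinuousLinearMap.adjoint_inner_left, real_inner_comm]

theorem hsNorm_eq_of_basis [CompleteSpace E] [CompleteSpace F] {ι : Type*}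
    (b : HilbertBasis ι ℝ E) (T : E →L[ℝ] F) :
    hsNorm T = (∑' i, ‖T (b i)‖ₑ ^ 2) ^ (1 / 2 : ℝ) := by
  obtain ⟨w, d, -⟩ := exists_hilbertBasis ℝ F
  rw [hsNorm, tsum_enorm_sq_adjoint _ d, tsum_enorm_sq_adjoint b d]

/-- The Hilbert-Schmidt inner product of `T` and `x ⊗ y` is `⟨T x, y⟩`. -/
theorem hasSum_inner_tensor [CompleteSpace E] [CompleteSpace F] {ι : Type*}
    (b : HilbertBasis ι ℝ E) (T : E →L[ℝ] F) (x : E) (y : F) :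
    HasSum (fun k => (inner ℝ (T (b k)) (tensor x y (b k)) : ℝ)) (inner ℝ (T x) y) := by
  have h := b.hasSum_inner_mul_inner x (ContinuousLinearMap.adjoint T y)
  rw [ContinuousLinearMap.adjoint_inner_right] at h
  refine h.congr_fun fun k => ?_
  rw [ContinuousLinearMap.adjoint_inner_right, tensor_apply, inner_smul_right]

/-- `(lam j, c j)`, `j = 0, 1, 2, …`, lists the eigenvalues of `A` in decreasing order with their
multiplicities, together with eigenvectors that form a complete orthonormal system. -/
structure IsEigenSystem (A : E →L[ℝ] E) (lam : ℕ → ℝ) (c : HilbertBasis ℕ ℝ E) : Prop where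
  antitone : Antitone lam
  apply_eq : ∀ j, A (c j) = lam j • c j

/-- The orthogonal projection onto the span of the first `K` vectors of a complete orthonormal
system. -/
def projFirst (c : HilbertBasis ℕ ℝ E) (K : ℕ) : E →L[ℝ] E :=
  ∑ j ∈ Finset.range K, tensor (c j) (c j)

end Operators

/-- `Λ_K = sup_{1 ≤ j ≤ K} (λ_j - λ_{j+1})⁻¹`, for the eigenvalues `λ_{j+1} = lam j`. -/
def gapSup (lam : ℕ → ℝ) (K : ℕ) : ℝ := ⨆ j : Fin K, (lam j - lam (j + 1))⁻¹

/-! ### Stochastic boundedness and processes -/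

section Processes

variable {Ω : Type*} [MeasurableSpace Ω]

/-- `Y_N = O_P(r_N)` for `N → ∞`. -/
def IsBigOInProb (μ : Measure Ω) (Y : ℕ → Ω → ℝ≥0∞) (r : ℕ → ℝ) : Prop :=
  ∀ δ : ℝ, 0 < δ → ∃ M : ℝ, 0 < M ∧
    ∀ᶠ N in atTop, μ {ω | ENNReal.ofReal (M * r N) < Y N ω} ≤ ENNReal.ofReal δ

/-- The cross-covariance operator `E[(X - E X) ⊗ (Y - E Y)]`. -/
def crossCov {E F : Type*} [NormedAddCommGroup E] [InnerProductSpace ℝ E]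
    [NormedAddCommGroup F] [InnerProductSpace ℝ F]
    (μ : Measure Ω) (X : Ω → E) (Y : Ω → F) : E →L[ℝ] F :=
  ∫ ω, tensor (X ω - ∫ ω', X ω' ∂μ) (Y ω - ∫ ω', Y ω' ∂μ) ∂μ

/-- The covariance operator. -/
def cov {E : Type*} [NormedAddCommGroup E] [InnerProductSpace ℝ E]
    (μ : Measure Ω) (X : Ω → E) : E →L[ℝ] E := crossCov μ X X

variable {H : Type*} [NormedAddCommGroup H] [InnerProductSpace ℝ H]

/-- Strict stationarity: equality of the shifted finite-dimensional distributions. -/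
structure IsStationary [MeasurableSpace H] (μ : Measure Ω) (X : ℤ → Ω → H) : Prop where
  aemeasurable : ∀ k, AEMeasurable (X k) μ
  map_eq : ∀ (n : ℕ) (t : Fin n → ℤ) (h : ℤ),
    μ.map (fun ω i => X (t i + h) ω) = μ.map (fun ω i => X (t i) ω)

/-- Ergodicity of a stationary process: the shift is ergodic for the law of the process. -/
def IsErgodicProcess [MeasurableSpace H] (μ : Measure Ω) (X : ℤ → Ω → H) : Prop :=
  Ergodic (fun (x : ℤ → H) (k : ℤ) => x (k + 1)) (μ.map (fun ω k => X k ω))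

structure IsWeaklyStationary (μ : Measure Ω) (X : ℤ → Ω → H) : Prop where
  memLp : ∀ k, MemLp (X k) 2 μ
  mean_eq : ∃ m : H, ∀ k, ∫ ω, X k ω ∂μ = m
  crossCov_eq : ∀ h k l : ℤ, crossCov μ (X k) (X l) = crossCov μ (X (k + h)) (X (l + h))

structure IsWhiteNoise (μ : Measure Ω) (ε : ℤ → Ω → H) : Prop where
  weaklyStationary : IsWeaklyStationary μ ε
  centered : ∀ k, ∫ ω, ε k ω ∂μ = 0
  pos : ∀ k, 0 < ∫ ω, ‖ε k ω‖ ^ 2 ∂μ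
  uncorrelated : ∀ k l : ℤ, k ≠ l → crossCov μ (ε k) (ε l) = 0

/-- `X_k = ε_k + ∑_{j=1}^q β_j(ε_{k-j})` almost surely, with `q ≥ 1` and `β_q ≠ 0`. The value
`β 0` is irrelevant. -/
structure IsFMA (μ : Measure Ω) (X ε : ℤ → Ω → H) (q : ℕ) (β : ℕ → H →L[ℝ] H) : Prop where
  one_le : 1 ≤ q
  ne_zero : β q ≠ 0
  eq : ∀ k : ℤ, ∀ᵐ ω ∂μ, X k ω = ε k ω + ∑ j ∈ Finset.Icc 1 q, β j (ε (k - j) ω)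

/-- `X` is a centered stationary process with `X_k = ∑_{j ≥ 1} ψ_j(X_{k-j}) + ε_k` almost surely.
The value `ψ 0` is irrelevant. -/
structure IsInvertible [MeasurableSpace H] (μ : Measure Ω) (X ε : ℤ → Ω → H)
    (ψ : ℕ → H →L[ℝ] H) : Prop where
  stationary : IsStationary μ X
  centered : ∀ k, ∫ ω, X k ω ∂μ = 0
  eq : ∀ k : ℤ, ∀ᵐ ω ∂μ,
    HasSum (fun j : ℕ => ψ (j + 1) (X (k - (j + 1)) ω)) (X k ω - ε k ω)

/-! ### The estimators -/

/-- The Hilbert space `H^L` with inner product `∑ᵢ ⟨xᵢ, yᵢ⟩`. -/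
abbrev Pow (H : Type*) (L : ℕ) : Type _ := PiLp 2 (fun _ : Fin L => H)

/-- `X^{[L]}_k = (X_k, X_{k-1}, …, X_{k-L+1})`. -/
def lagVec (X : ℤ → Ω → H) (L : ℕ) (k : ℤ) (ω : Ω) : Pow H L :=
  WithLp.toLp 2 (fun i : Fin L => X (k - (i : ℕ)) ω)

/-- The covariance operator of `X^{[L]}`. -/
def lagCov (μ : Measure Ω) (X : ℤ → Ω → H) (L : ℕ) : Pow H L →L[ℝ] Pow H L :=
  cov μ (lagVec X L 0)

/-- The lag-1-cross-covariance operator of `X^{[L]}` and `X`. -/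
def lagCrossCov (μ : Measure Ω) (X : ℤ → Ω → H) (L : ℕ) : Pow H L →L[ℝ] H :=
  crossCov μ (lagVec X L 0) (X 1)

/-- The empirical version of `lagCov` from the sample `X_1, …, X_N`. -/
def empCov (X : ℤ → Ω → H) (L N : ℕ) (ω : Ω) : Pow H L →L[ℝ] Pow H L :=
  ((N : ℝ) - L + 1)⁻¹ • ∑ k ∈ Finset.Icc L N, tensor (lagVec X L k ω) (lagVec X L k ω)

/-- The empirical version of `lagCrossCov` from the sample `X_1, …, X_N`. -/
def empCrossCov (X : ℤ → Ω → H) (L N : ℕ) (ω : Ω) : Pow H L →L[ℝ] H :=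
  ((N : ℝ) - L)⁻¹ • ∑ k ∈ Finset.Ico L N, tensor (lagVec X L k ω) (X (k + 1) ω)

/-- The operator `(ψ_1 ⋯ ψ_L) : H^L → H`. -/
def rowOp (ψ : ℕ → H →L[ℝ] H) (L : ℕ) : Pow H L →L[ℝ] H :=
  ∑ i : Fin L, ψ (i + 1) ∘L PiLp.proj 2 (fun _ : Fin L => H) i

/-- The `j`-th component, `1 ≤ j ≤ L`, of an operator `H^L → H` (zero for all other `j`). -/
def component {L : ℕ} (T : Pow H L →L[ℝ] H) (j : ℕ) : H →L[ℝ] H :=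
  if hj : 1 ≤ j ∧ j ≤ L then
    T ∘L (PiLp.continuousLinearEquiv 2 ℝ (fun _ : Fin L => H)).symm.toContinuousLinearMap ∘L
      ContinuousLinearMap.single ℝ (fun _ : Fin L => H) ⟨j - 1, by omega⟩
  else 0

/-- The estimator `D̂ (Ĉ + θ I)⁻¹ ∐` of `(ψ_1 ⋯ ψ_L)`, where `∐` projects onto the span of the first
`K` vectors of `c`, to be used with an eigenbasis `c` of `Ĉ`. -/
def rowHat (X : ℤ → Ω → H) (L N K : ℕ) (θ : ℝ) (c : HilbertBasis ℕ ℝ (Pow H L)) (ω : Ω) :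
    Pow H L →L[ℝ] H :=
  empCrossCov X L N ω ∘L
    Ring.inverse (empCov X L N ω + θ • ContinuousLinearMap.id ℝ (Pow H L)) ∘L projFirst c K

/-- `φ_0 = I` and `φ_i = ∑_{j=1}^i ψ_j φ_{i-j}` for `i ≥ 1`. -/
def causalOp (ψ : ℕ → H →L[ℝ] H) : ℕ → H →L[ℝ] H
  | 0 => ContinuousLinearMap.id ℝ H
  | i + 1 => ∑ j : Fin (i + 1), ψ (j + 1) ∘L causalOp ψ (i - j)
termination_by i => i
decreasing_by omega

/-- `β̂_j = φ̂_j`, computed recursively from the components of the estimator of `(ψ_1 ⋯ ψ_L)`. -/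
def betaHat (X : ℤ → Ω → H) (L N K : ℕ) (θ : ℝ) (c : HilbertBasis ℕ ℝ (Pow H L)) (ω : Ω) (j : ℕ) :
    H →L[ℝ] H :=
  causalOp (component (rowHat X L N K θ c ω)) j

/-- `∑_{i,j ≥ 1} ⟨T, c_i ⊗ d_j⟩_S² (1 + i^{2b} + j^{2b})`, where `⟨T, c ⊗ d⟩_S = ⟨T c, d⟩`
(see `hasSum_inner_tensor`); both bases are indexed from `0`. -/
def sobolevSum {E : Type*} [NormedAddCommGroup E] [InnerProductSpace ℝ E]
    (T : E →L[ℝ] H) (c : HilbertBasis ℕ ℝ E) (d : HilbertBasis ℕ ℝ H) (b : ℝ) : ℝ≥0∞ :=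
  ∑' i : ℕ, ∑' j : ℕ, ENNReal.ofReal
    ((inner ℝ (T (c i)) (d j)) ^ 2 * (1 + ((i : ℝ) + 1) ^ (2 * b) + ((j : ℝ) + 1) ^ (2 * b)))

end Processes

end FMA

end

/-! There are two halves: an identity between operators, and a deterministic error bound on an event
of large probability.

Identity. Take second moments of `X_m` against the noise `ε_0`. The moving average gives `β_m C_ε`
for `m ≤ q`, and the inverted representation gives `∑_{j ≤ m} ψ_j β_{m-j} C_ε`, since noise is
uncorrelated with the past of `X`. The injective operator `C_ε` cancels, so `β_1, …, β_q` obey the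
recursion that defines `φ_j` (`IsInvertible.causalOp_eq`). Estimator and target are thus one
recursion evaluated at two sequences. It is locally Lipschitz (`exists_hsNorm_causalOp_sub_le`), so
it suffices to bound the Hilbert-Schmidt error of the row estimator.

Error bound. Since `ε_1` is uncorrelated with `X^{[L]}_0`, `D = Ψ C + R`, where `R` comes from the
tail `∑_{ℓ > L} ψ_ℓ(X_{1-ℓ})` (`IsFMA.lagCrossCov_eq`). Write `P`, `P̂` for the projections onto the
first `K` eigenvectors of `C`, `Ĉ`, and `T = (Ĉ + θ)⁻¹ P̂`. From `Ĉ T = P̂ - θ T`, `D̂ T - Ψ = (D̂ -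
D + R - Ψ(Ĉ - C) - θ Ψ) T + Ψ(P̂ - P) - (Ψ - Ψ P)`. Weyl's inequality gives `‖T‖ ≤ 2/λ_K`, and a gap
argument gives `‖P̂ - P‖_S ≤ 2 Λ_K ‖Ĉ - C‖_S`. Comparing whole projections avoids any choice of
signs of eigenvectors. The Sobolev sum bounds the last term by `K^{-β} √S`, and the rate conditions
make every other term `O(K^{-β})` (`hsNorm_rowHat_sub_le`). This uses a bound on `λ_1` that is
uniform in `L` (`IsFMA.inner_lagCov_le`). -/

noncomputable section

namespace FMA

/-! ### Hilbert-Schmidt norms -/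

section HilbertSchmidt

theorem enorm_apply_le {E F : Type*} [NormedAddCommGroup E] [InnerProductSpace ℝ E]
    [NormedAddCommGroup F] [InnerProductSpace ℝ F] (T : E →L[ℝ] F) (x : E) :
    ‖T x‖ₑ ≤ ‖T‖ₑ * ‖x‖ₑ := by
  simp only [enorm_eq_nnnorm, ← ENNReal.coe_mul]
  exact_mod_cast T.le_opNNNorm x

variable {E F G : Type*} [NormedAddCommGroup E] [InnerProductSpace ℝ E] [CompleteSpace E]
  [NormedAddCommGroup F] [InnerProductSpace ℝ F] [CompleteSpace F]
  [NormedAddCommGroup G] [InnerProductSpace ℝ G] [CompleteSpace G]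

theorem hsNorm_sq {ι : Type*} (b : HilbertBasis ι ℝ E) (T : E →L[ℝ] F) :
    hsNorm T ^ 2 = ∑' i, ‖T (b i)‖ₑ ^ 2 := by
  rw [hsNorm_eq_of_basis b, ← ENNReal.rpow_natCast, ← ENNReal.rpow_mul]
  norm_num

theorem le_of_sq_le_sq {a b : ℝ≥0∞} (h : a ^ 2 ≤ b ^ 2) : a ≤ b :=
  (ENNReal.pow_le_pow_left_iff two_ne_zero).1 h

/-- The norm does not depend on the basis, so the comparison can be made on one adapted to the
operators, such as an eigenbasis. -/
theorem hsNorm_le_mul_of_basis {ι : Type*} (b : HilbertBasis ι ℝ E) (S : E →L[ℝ] F)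
    (T : E →L[ℝ] G) (r : ℝ≥0∞) (h : ∀ i, ‖S (b i)‖ₑ ≤ r * ‖T (b i)‖ₑ) :
    hsNorm S ≤ r * hsNorm T := by
  refine le_of_sq_le_sq ?_
  rw [mul_pow, hsNorm_sq b, hsNorm_sq b, ← ENNReal.tsum_mul_left]
  refine ENNReal.tsum_le_tsum fun i => ?_
  rw [← mul_pow]
  exact pow_le_pow_left₀ zero_le (h i) 2

/-- Minkowski's inequality for the counting measure on a basis; infinite values are covered too. -/
theorem hsNorm_add_le (S T : E →L[ℝ] F) : hsNorm (S + T) ≤ hsNorm S + hsNorm T := by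
  obtain ⟨w, b, -⟩ := exists_hilbertBasis ℝ E
  let _ : MeasurableSpace w := ⊤
  have h := ENNReal.lintegral_Lp_add_le (μ := Measure.count) (p := 2)
    (f := fun i : w => ‖S (b i)‖ₑ) (g := fun i : w => ‖T (b i)‖ₑ)
    measurable_from_top.aemeasurable measurable_from_top.aemeasurable one_le_two
  rw [lintegral_count' measurable_from_top, lintegral_count' measurable_from_top,
    lintegral_count' measurable_from_top] at h
  simp only [ENNReal.rpow_two] at h
  rw [hsNorm_eq_of_basis b S, hsNorm_eq_of_basis b T, hsNorm_eq_of_basis b (S + T)]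
  refine le_trans ?_ h
  gcongr with i
  exact enorm_add_le _ _

theorem hsNorm_adjoint (T : E →L[ℝ] F) : hsNorm (ContinuousLinearMap.adjoint T) = hsNorm T := by
  obtain ⟨w, b, -⟩ := exists_hilbertBasis ℝ E
  obtain ⟨v, d, -⟩ := exists_hilbertBasis ℝ F
  rw [hsNorm_eq_of_basis b, hsNorm_eq_of_basis d, tsum_enorm_sq_adjoint b d]

theorem hsNorm_comp_le_left (S : F →L[ℝ] G) (T : E →L[ℝ] F) :
    hsNorm (S ∘L T) ≤ ‖S‖ₑ * hsNorm T := by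
  obtain ⟨w, b, -⟩ := exists_hilbertBasis ℝ E
  exact hsNorm_le_mul_of_basis b _ _ _ fun i => enorm_apply_le S _

theorem hsNorm_comp_le_right (S : F →L[ℝ] G) (T : E →L[ℝ] F) :
    hsNorm (S ∘L T) ≤ hsNorm S * ‖T‖ₑ := by
  rw [← hsNorm_adjoint, ContinuousLinearMap.adjoint_comp, ← hsNorm_adjoint S, mul_comm]
  refine (hsNorm_comp_le_left _ _).trans_eq ?_
  rw [← ofReal_norm, ← ofReal_norm, LinearIsometryEquiv.norm_map]

theorem hsNorm_smul (r : ℝ) (T : E →L[ℝ] F) : hsNorm (r • T) ≤ ‖r‖ₑ * hsNorm T := by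
  obtain ⟨w, b, -⟩ := exists_hilbertBasis ℝ E
  refine hsNorm_le_mul_of_basis b _ _ _ fun i => ?_
  rw [smul_apply, enorm_smul]

theorem hsNorm_zero : hsNorm (0 : E →L[ℝ] F) = 0 := by
  obtain ⟨w, b, -⟩ := exists_hilbertBasis ℝ E
  simpa using hsNorm_sq b (0 : E →L[ℝ] F)

theorem hsNorm_neg (T : E →L[ℝ] F) : hsNorm (-T) = hsNorm T := by
  obtain ⟨w, b, -⟩ := exists_hilbertBasis ℝ E
  rw [hsNorm_eq_of_basis b, hsNorm_eq_of_basis b]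
  simp

theorem hsNorm_sub_le (S T : E →L[ℝ] F) : hsNorm (S - T) ≤ hsNorm S + hsNorm T := by
  rw [sub_eq_add_neg, ← hsNorm_neg T]
  exact hsNorm_add_le _ _

theorem hsNorm_sum_le {ι : Type*} (s : Finset ι) (T : ι → E →L[ℝ] F) :
    hsNorm (∑ i ∈ s, T i) ≤ ∑ i ∈ s, hsNorm (T i) :=
  Finset.le_sum_of_subadditive _ hsNorm_zero.le hsNorm_add_le s T

theorem enorm_apply_le_hsNorm (T : E →L[ℝ] F) (x : E) : ‖T x‖ₑ ≤ hsNorm T * ‖x‖ₑ := by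
  obtain ⟨v, d, -⟩ := exists_hilbertBasis ℝ F
  refine le_of_sq_le_sq ?_
  rw [← hsNorm_adjoint, mul_pow, hsNorm_sq d, enorm_sq_eq_tsum d, ← ENNReal.tsum_mul_right]
  refine ENNReal.tsum_le_tsum fun i => ?_
  rw [← mul_pow, ← ContinuousLinearMap.adjoint_inner_right, mul_comm]
  refine pow_le_pow_left₀ zero_le ?_ 2
  simp only [enorm_eq_nnnorm, ← ENNReal.coe_mul]
  exact_mod_cast nnnorm_inner_le_nnnorm (𝕜 := ℝ) _ _

theorem norm_le_of_hsNorm_le {T : E →L[ℝ] F} {r : ℝ} (hr : 0 ≤ r)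
    (h : hsNorm T ≤ ENNReal.ofReal r) : ‖T‖ ≤ r := by
  refine T.opNorm_le_bound hr fun x => ?_
  have h1 := (enorm_apply_le_hsNorm T x).trans (mul_le_mul_left h _)
  rw [← ofReal_norm, ← ofReal_norm, ← ENNReal.ofReal_mul hr] at h1
  exact (ENNReal.ofReal_le_ofReal_iff (by positivity)).1 h1

end HilbertSchmidt

/-! ### Perturbation of eigenvalues and eigenprojections -/

section Perturbation

variable {E F : Type*} [NormedAddCommGroup E] [InnerProductSpace ℝ E]
  [NormedAddCommGroup F] [InnerProductSpace ℝ F]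

theorem hasSum_inner_sq {ι : Type*} (c : HilbertBasis ι ℝ E) (x : E) :
    HasSum (fun i => (inner ℝ (c i) x : ℝ) ^ 2) (‖x‖ ^ 2) := by
  have h := c.hasSum_inner_mul_inner x x
  rw [real_inner_self_eq_norm_sq] at h
  refine h.congr_fun fun i => ?_
  rw [real_inner_comm x (c i), sq]

theorem norm_le_mul_of_coord {ι : Type*} (c : HilbertBasis ι ℝ E) {x y : E} {r : ℝ} (hr : 0 ≤ r)
    (h : ∀ i, |(inner ℝ (c i) x : ℝ)| ≤ r * |(inner ℝ (c i) y : ℝ)|) : ‖x‖ ≤ r * ‖y‖ := by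
  refine (sq_le_sq₀ (norm_nonneg _) (by positivity)).1 ?_
  rw [mul_pow]
  refine hasSum_le (fun i => ?_) (hasSum_inner_sq c x) ((hasSum_inner_sq c y).mul_left _)
  rw [← sq_abs, ← sq_abs (inner ℝ (c i) y), ← mul_pow]
  exact pow_le_pow_left₀ (abs_nonneg _) (h i) 2

theorem inner_basis {ι : Type*} [DecidableEq ι] (c : HilbertBasis ι ℝ E) (i j : ι) :
    (inner ℝ (c i) (c j) : ℝ) = if i = j then 1 else 0 :=
  orthonormal_iff_ite.1 c.orthonormal i j

namespace IsEigenSystem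

variable {A B : E →L[ℝ] E} {lam mu : ℕ → ℝ} {c e : HilbertBasis ℕ ℝ E}

theorem hasSum_inner_apply (h : IsEigenSystem A lam c) (x y : E) :
    HasSum (fun i => lam i * (inner ℝ (c i) x * inner ℝ (c i) y)) (inner ℝ (A x) y : ℝ) := by
  have h1 := (c.hasSum_repr x).mapL A
  have h2 := h1.mapL (innerSL ℝ y)
  simp only [innerSL_apply_apply] at h2
  rw [real_inner_comm] at h2
  refine h2.congr_fun fun i => ?_
  rw [map_smul, h.apply_eq, c.repr_apply_apply, inner_smul_right, inner_smul_right,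
    real_inner_comm y (c i)]
  ring

theorem inner_apply (h : IsEigenSystem A lam c) (i : ℕ) (x : E) :
    (inner ℝ (c i) (A x) : ℝ) = lam i * inner ℝ (c i) x := by
  rw [real_inner_comm]
  refine (h.hasSum_inner_apply x (c i)).unique ?_
  convert hasSum_single i ?_ using 1
  · rw [inner_basis, if_pos rfl, mul_one]
  · intro j hj
    simp [inner_basis, hj]

theorem eq_inner (h : IsEigenSystem A lam c) (i : ℕ) : lam i = inner ℝ (A (c i)) (c i) := by
  rw [h.apply_eq, inner_smul_left, inner_basis]
  simp

/-- Dimension count: `k` linear conditions on a span of dimension `k + 1`. The vector found is the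
test vector of the min-max argument. -/
theorem exists_combination_orthogonal (c e : HilbertBasis ℕ ℝ E) (k : ℕ) :
    ∃ x : E, x ≠ 0 ∧ (∀ j, k < j → (inner ℝ (c j) x : ℝ) = 0) ∧
      ∀ i, i < k → (inner ℝ (e i) x : ℝ) = 0 := by
  let comb : (Fin (k + 1) → ℝ) →ₗ[ℝ] E := Fintype.linearCombination ℝ (fun j : Fin (k + 1) => c j)
  let f : (Fin (k + 1) → ℝ) →ₗ[ℝ] (Fin k → ℝ) :=
    LinearMap.pi fun i : Fin k => (innerSL ℝ (e i)).toLinearMap ∘ₗ comb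
  have hf : f.ker ≠ ⊥ := LinearMap.ker_ne_bot_of_finrank_lt (by simp)
  obtain ⟨a, ha, ha0⟩ := (Submodule.ne_bot_iff _).1 hf
  have hc : ∀ j, (inner ℝ (c j) (comb a) : ℝ) = ∑ i : Fin (k + 1), if j = i then a i else 0 := by
    intro j
    rw [Fintype.linearCombination_apply, inner_sum]
    refine Finset.sum_congr rfl fun i _ => ?_
    rw [inner_smul_right, inner_basis]
    simp
  refine ⟨comb a, fun h0 => ha0 (funext fun i => ?_), fun j hj => ?_, fun i hi => ?_⟩
  · have h1 := hc i
    rw [h0, inner_zero_right, Finset.sum_eq_single i] at h1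
    · simpa using h1.symm
    · intro l _ hl
      rw [if_neg]
      exact fun h => hl (Fin.ext h.symm)
    · simp
  · rw [hc]
    refine Finset.sum_eq_zero fun i _ => if_neg ?_
    have := i.2
    omega
  · exact congrFun (LinearMap.mem_ker.1 ha) ⟨i, hi⟩

/-- Weyl's inequality. -/
theorem eigenvalue_sub_le (h : IsEigenSystem A lam c) (h' : IsEigenSystem B mu e) (k : ℕ) :
    lam k - mu k ≤ ‖B - A‖ := by
  obtain ⟨x, hx, hxc, hxe⟩ := exists_combination_orthogonal c e k
  have h1 : lam k * ‖x‖ ^ 2 ≤ inner ℝ (A x) x := by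
    refine hasSum_le (fun i => ?_) ((hasSum_inner_sq c x).mul_left _) (h.hasSum_inner_apply x x)
    rcases le_or_gt i k with hi | hi
    · rw [← sq]
      exact mul_le_mul_of_nonneg_right (h.antitone hi) (sq_nonneg _)
    · simp [hxc i hi]
  have h2 : inner ℝ (B x) x ≤ mu k * ‖x‖ ^ 2 := by
    refine hasSum_le (fun i => ?_) (h'.hasSum_inner_apply x x) ((hasSum_inner_sq e x).mul_left _)
    rcases lt_or_ge i k with hi | hi
    · simp [hxe i hi]
    · rw [← sq]
      exact mul_le_mul_of_nonneg_right (h'.antitone hi) (sq_nonneg _)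
  have h3 : inner ℝ (A x) x - inner ℝ (B x) x ≤ ‖B - A‖ * ‖x‖ ^ 2 := by
    have h4 : (inner ℝ (A x) x - inner ℝ (B x) x : ℝ) = inner ℝ (-((B - A) x)) x := by
      rw [sub_apply, neg_sub, inner_sub_left]
    rw [h4]
    refine (real_inner_le_norm _ _).trans ?_
    rw [norm_neg, sq, ← mul_assoc]
    exact mul_le_mul_of_nonneg_right ((B - A).le_opNorm x) (norm_nonneg _)
  have h5 : 0 < ‖x‖ ^ 2 := by positivity
  refine le_of_mul_le_mul_right ?_ h5
  linarith

end IsEigenSystem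

theorem projFirst_apply (c : HilbertBasis ℕ ℝ E) (K : ℕ) (x : E) :
    projFirst c K x = ∑ j ∈ Finset.range K, (inner ℝ (c j) x : ℝ) • c j := by
  simp [projFirst, tensor_apply]

theorem inner_projFirst (c : HilbertBasis ℕ ℝ E) (K i : ℕ) (x : E) :
    (inner ℝ (c i) (projFirst c K x) : ℝ) = if i < K then inner ℝ (c i) x else 0 := by
  rw [projFirst_apply, inner_sum]
  simp [inner_smul_right, inner_basis]

theorem projFirst_basis (c : HilbertBasis ℕ ℝ E) (K i : ℕ) :
    projFirst c K (c i) = if i < K then c i else 0 := by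
  rw [projFirst_apply]
  simp [inner_basis]

theorem sub_comp_projFirst_basis (T : E →L[ℝ] F) (c : HilbertBasis ℕ ℝ E) (K i : ℕ) :
    (T - T ∘L projFirst c K) (c i) = if i < K then 0 else T (c i) := by
  rw [sub_apply, ContinuousLinearMap.comp_apply, projFirst_basis]
  split_ifs <;> simp

namespace IsEigenSystem

variable {A B : E →L[ℝ] E} {lam mu : ℕ → ℝ} {c e : HilbertBasis ℕ ℝ E}

/-- Perturbation of the projection onto the first `K` eigenvectors, for a gap `g` between the
`K`-th and the next eigenvalue. -/
theorem hsNorm_projFirst_sub_le [CompleteSpace E] (h : IsEigenSystem A lam c)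
    (h' : IsEigenSystem B mu e) {K : ℕ} (hK : 1 ≤ K) {g : ℝ} (hg : 0 < g)
    (hgap : g ≤ lam (K - 1) - lam K) (hδ : ‖B - A‖ ≤ g / 2) :
    hsNorm (projFirst e K - projFirst c K) ≤ ENNReal.ofReal (2 / g) * hsNorm (B - A) := by
  refine hsNorm_le_mul_of_basis e _ _ _ fun j => ?_
  rw [← ofReal_norm, ← ofReal_norm, ← ENNReal.ofReal_mul (by positivity)]
  refine ENNReal.ofReal_le_ofReal (norm_le_mul_of_coord c (by positivity) fun i => ?_)
  -- In the mixed bases the entries are `(1_{j<K} - 1_{i<K})⟨c_i, e_j⟩` for the projections and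
  -- `(mu_j - lam_i)⟨c_i, e_j⟩` for `B - A`. The former vanish unless `i` and `j` lie on opposite
  -- sides of `K`, where Weyl's inequality leaves `|mu_j - lam_i| ≥ g / 2`.
  rw [sub_apply, sub_apply, inner_sub_right,
    inner_sub_right, inner_projFirst, projFirst_basis, h'.apply_eq, h.inner_apply,
    inner_smul_right, ← sub_mul, abs_mul, ← mul_assoc]
  have hlow : g / 2 ≤ mu (K - 1) - lam K := by
    have := h.eigenvalue_sub_le h' (K - 1)
    linarith
  have hup : g / 2 ≤ lam (K - 1) - mu K := by
    have := h'.eigenvalue_sub_le h K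
    rw [norm_sub_rev] at this
    linarith
  have key : g / 2 ≤ |mu j - lam i| → 1 ≤ 2 / g * |mu j - lam i| := by
    intro hh
    calc (1 : ℝ) = 2 / g * (g / 2) := by field_simp
      _ ≤ _ := by gcongr
  by_cases hj : j < K <;> by_cases hi : i < K <;> simp only [hi, hj, if_true, if_false]
  · simp only [sub_self, abs_zero]
    positivity
  · rw [sub_zero]
    refine le_mul_of_one_le_left (abs_nonneg _) (key ?_)
    refine le_trans ?_ (le_abs_self _)
    have h1 : mu (K - 1) ≤ mu j := h'.antitone (by omega)
    have h2 : lam i ≤ lam K := h.antitone (by omega)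
    linarith
  · rw [inner_zero_right, zero_sub, abs_neg]
    refine le_mul_of_one_le_left (abs_nonneg _) (key ?_)
    rw [abs_sub_comm]
    refine le_trans ?_ (le_abs_self _)
    have h1 : mu j ≤ mu K := h'.antitone (by omega)
    have h2 : lam (K - 1) ≤ lam i := h.antitone (by omega)
    linarith
  · simp only [inner_zero_right, sub_self, abs_zero]
    positivity

/-- Coercivity: a nonnegative spectrum gives `⟨(A + θ)x, x⟩ ≥ θ‖x‖²`. This makes `Ring.inverse` a
true inverse instead of its default value `0`. -/
theorem isUnit_add_smul_id [CompleteSpace E] (h : IsEigenSystem A lam c) (h0 : ∀ i, 0 ≤ lam i)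
    {θ : ℝ} (hθ : 0 < θ) : IsUnit (A + θ • ContinuousLinearMap.id ℝ E) := by
  refine ContinuousLinearMap.isUnit_of_forall_le_norm_inner_map _ (c := ⟨θ, hθ.le⟩) hθ fun x => ?_
  refine le_trans ?_ (le_abs_self _)
  have h1 : (0 : ℝ) ≤ inner ℝ (A x) x :=
    (h.hasSum_inner_apply x x).nonneg fun i => mul_nonneg (h0 i) (mul_self_nonneg _)
  simp only [add_apply, smul_apply,
    ContinuousLinearMap.id_apply, inner_add_left, inner_smul_left, real_inner_self_eq_norm_sq,
    RCLike.conj_to_real]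
  change ‖x‖ ^ 2 * θ ≤ _
  linarith

theorem inverse_apply [CompleteSpace E] (h : IsEigenSystem A lam c) (h0 : ∀ i, 0 ≤ lam i)
    {θ : ℝ} (hθ : 0 < θ) (i : ℕ) :
    Ring.inverse (A + θ • ContinuousLinearMap.id ℝ E) (c i) = (lam i + θ)⁻¹ • c i := by
  have hne : lam i + θ ≠ 0 := by have := h0 i; positivity
  have h1 : (A + θ • ContinuousLinearMap.id ℝ E) (c i) = (lam i + θ) • c i := by
    simp [h.apply_eq, add_smul]
  have h2 : Ring.inverse (A + θ • ContinuousLinearMap.id ℝ E)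
      ((A + θ • ContinuousLinearMap.id ℝ E) (c i)) = c i :=
    congrArg (fun T : E →L[ℝ] E => T (c i))
      (Ring.inverse_mul_cancel _ (h.isUnit_add_smul_id h0 hθ))
  rw [h1, map_smul] at h2
  rw [eq_inv_smul_iff₀ hne, h2]

/-- The operator is diagonal with entries `(lam i + θ)⁻¹` for `i < K`, so cutting at `K` gives a
bound that does not deteriorate as `θ → 0`. -/
theorem norm_inverse_comp_projFirst_le [CompleteSpace E] (h : IsEigenSystem A lam c)
    (h0 : ∀ i, 0 ≤ lam i) {θ : ℝ} (hθ : 0 < θ) {K : ℕ} {l : ℝ} (hl : 0 < l)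
    (hK : l ≤ lam (K - 1)) :
    ‖Ring.inverse (A + θ • ContinuousLinearMap.id ℝ E) ∘L projFirst c K‖ ≤ l⁻¹ := by
  refine ContinuousLinearMap.opNorm_le_bound _ (by positivity) fun x => ?_
  refine norm_le_mul_of_coord c (by positivity) fun i => ?_
  rw [ContinuousLinearMap.comp_apply, projFirst_apply, map_sum, inner_sum]
  have h1 : ∀ j ∈ Finset.range K, (inner ℝ (c i) ((Ring.inverse
      (A + θ • ContinuousLinearMap.id ℝ E)) ((inner ℝ (c j) x : ℝ) • c j)) : ℝ) =
      if i = j then (lam i + θ)⁻¹ * inner ℝ (c i) x else 0 := by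
    intro j _
    rw [map_smul, h.inverse_apply h0 hθ, inner_smul_right, inner_smul_right, inner_basis]
    split_ifs with hij
    · subst hij; ring
    · simp
  rw [Finset.sum_congr rfl h1, Finset.sum_ite_eq]
  split_ifs with hi
  · have h2 : l ≤ lam i + θ := by
      have : lam (K - 1) ≤ lam i := h.antitone (by have := Finset.mem_range.1 hi; omega)
      linarith
    rw [abs_mul, abs_of_pos (inv_pos.2 (hl.trans_le h2))]
    gcongr
  · simp only [abs_zero]
    positivity

end IsEigenSystem

end Perturbation

/-! ### Deterministic error bounds for the estimators -/

section EstimatorError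

variable {E F : Type*} [NormedAddCommGroup E] [InnerProductSpace ℝ E] [CompleteSpace E]
  [NormedAddCommGroup F] [InnerProductSpace ℝ F] [CompleteSpace F]

/-- `A`, `B` play the roles of `C`, `Ĉ`, and `D`, `D'` those of the true and empirical
cross-covariances. The bound estimates the decomposition `hdec` term by term. -/
theorem IsEigenSystem.hsNorm_estimator_sub_le {A B : E →L[ℝ] E} {lam mu : ℕ → ℝ}
    {c e : HilbertBasis ℕ ℝ E} (h : IsEigenSystem A lam c) (h' : IsEigenSystem B mu e)
    (hmu : ∀ i, 0 ≤ mu i) {Ψ D D' R : E →L[ℝ] F} (hD : D = Ψ ∘L A + R) {θ : ℝ} (hθ : 0 < θ)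
    {K : ℕ} (hK : 1 ≤ K) {g : ℝ} (hg : 0 < g) (hlam : 0 ≤ lam K)
    (hgap : g ≤ lam (K - 1) - lam K) (hδ : ‖B - A‖ ≤ g / 2) :
    hsNorm (D' ∘L Ring.inverse (B + θ • ContinuousLinearMap.id ℝ E) ∘L projFirst e K - Ψ) ≤
      (hsNorm (D' - D) + hsNorm R + ‖Ψ‖ₑ * hsNorm (B - A) + ENNReal.ofReal θ * hsNorm Ψ) *
        ENNReal.ofReal (2 / lam (K - 1)) +
      ‖Ψ‖ₑ * (ENNReal.ofReal (2 / g) * hsNorm (B - A)) + hsNorm (Ψ - Ψ ∘L projFirst c K) := by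
  set G := Ring.inverse (B + θ • ContinuousLinearMap.id ℝ E) with hG
  set T := G ∘L projFirst e K with hT
  have hl : 0 < lam (K - 1) := by linarith
  have hGinv : B ∘L G = ContinuousLinearMap.id ℝ E - θ • G := by
    have h1 : (B + θ • ContinuousLinearMap.id ℝ E) ∘L G = ContinuousLinearMap.id ℝ E :=
      Ring.mul_inverse_cancel _ (h'.isUnit_add_smul_id hmu hθ)
    rw [← h1, ContinuousLinearMap.add_comp, ContinuousLinearMap.smul_comp,
      ContinuousLinearMap.id_comp, add_sub_cancel_right]
  have hBT : B ∘L T = projFirst e K - θ • T := by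
    rw [hT, ← ContinuousLinearMap.comp_assoc, hGinv, ContinuousLinearMap.sub_comp,
      ContinuousLinearMap.smul_comp, ContinuousLinearMap.id_comp]
  have hTnorm : ‖T‖ₑ ≤ ENNReal.ofReal (2 / lam (K - 1)) := by
    -- Weyl's inequality, with `g ≤ lam (K - 1)` because `lam K ≥ 0`.
    have h1 : lam (K - 1) / 2 ≤ mu (K - 1) := by
      have := h.eigenvalue_sub_le h' (K - 1)
      linarith
    have h2 := h'.norm_inverse_comp_projFirst_le hmu hθ (K := K) (half_pos hl) h1
    rw [← ofReal_norm]
    refine ENNReal.ofReal_le_ofReal (h2.trans_eq ?_)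
    rw [inv_div]
  have hdec : D' ∘L T - Ψ = (D' - D + R - Ψ ∘L (B - A) - θ • Ψ) ∘L T +
      Ψ ∘L (projFirst e K - projFirst c K) - (Ψ - Ψ ∘L projFirst c K) := by
    have h1 : Ψ ∘L (B ∘L T) = Ψ ∘L projFirst e K - θ • (Ψ ∘L T) := by
      rw [hBT, ContinuousLinearMap.comp_sub, ContinuousLinearMap.comp_smul]
    simp only [ContinuousLinearMap.sub_comp, ContinuousLinearMap.add_comp,
      ContinuousLinearMap.comp_sub, ContinuousLinearMap.smul_comp, hD,
      ContinuousLinearMap.comp_assoc, h1]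
    abel
  rw [hdec]
  refine (hsNorm_sub_le _ _).trans (add_le_add_left ((hsNorm_add_le _ _).trans ?_) _)
  refine add_le_add ((hsNorm_comp_le_right _ _).trans (mul_le_mul' ?_ hTnorm))
    ((hsNorm_comp_le_left _ _).trans ?_)
  · refine (hsNorm_sub_le _ _).trans (add_le_add ((hsNorm_sub_le _ _).trans
      (add_le_add (hsNorm_add_le _ _) (hsNorm_comp_le_left _ _))) ((hsNorm_smul _ _).trans_eq ?_))
    rw [Real.enorm_of_nonneg hθ.le]
  · gcongr
    exact h.hsNorm_projFirst_sub_le h' hK hg hgap hδ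

theorem hsNorm_sub_comp_projFirst_le (T : E →L[ℝ] F) (c : HilbertBasis ℕ ℝ E) (K : ℕ) :
    hsNorm (T - T ∘L projFirst c K) ≤ hsNorm T := by
  have h := hsNorm_le_mul_of_basis c (T - T ∘L projFirst c K) T 1 fun i => ?_
  · rwa [one_mul] at h
  · rw [sub_comp_projFirst_basis]
    split_ifs <;> simp

/-- Only the basis vectors with `i ≥ K` contribute to the residual, and their Sobolev weights are at
least `K^{2b}`. -/
theorem hsNorm_sub_comp_projFirst_sq_le (T : E →L[ℝ] F) (c : HilbertBasis ℕ ℝ E)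
    (d : HilbertBasis ℕ ℝ F) {K : ℕ} (hK : 1 ≤ K) {b : ℝ} (hb : 0 < b) :
    hsNorm (T - T ∘L projFirst c K) ^ 2 ≤
      ENNReal.ofReal ((K : ℝ) ^ (-b)) ^ 2 * sobolevSum T c d b := by
  have hK0 : (0 : ℝ) < K := by exact_mod_cast hK
  rw [hsNorm_sq c, sobolevSum, ← ENNReal.tsum_mul_left]
  refine ENNReal.tsum_le_tsum fun i => ?_
  rw [sub_comp_projFirst_basis]
  split_ifs with hi
  · simp
  · rw [enorm_sq_eq_tsum d, ← ENNReal.tsum_mul_left]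
    refine ENNReal.tsum_le_tsum fun j => ?_
    rw [← ENNReal.ofReal_pow (by positivity), ← ENNReal.ofReal_mul (by positivity), ← ofReal_norm,
      ← ENNReal.ofReal_pow (norm_nonneg _), Real.norm_eq_abs, sq_abs]
    refine ENNReal.ofReal_le_ofReal ?_
    have h1 : (K : ℝ) ^ (2 * b) ≤ 1 + ((i : ℝ) + 1) ^ (2 * b) + ((j : ℝ) + 1) ^ (2 * b) := by
      have h2 : (K : ℝ) ≤ (i : ℝ) + 1 := by
        have : (K : ℝ) ≤ i := by exact_mod_cast not_lt.1 hi
        linarith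
      have h3 := Real.rpow_le_rpow hK0.le h2 (by positivity : 0 ≤ 2 * b)
      have h4 : 0 ≤ ((j : ℝ) + 1) ^ (2 * b) := by positivity
      linarith
    have h5 : ((K : ℝ) ^ (-b)) ^ 2 * (K : ℝ) ^ (2 * b) = 1 := by
      rw [← Real.rpow_natCast, ← Real.rpow_mul hK0.le, ← Real.rpow_add hK0]
      rw [show -b * ((2 : ℕ) : ℝ) + 2 * b = 0 by push_cast; ring, Real.rpow_zero]
    calc (inner ℝ (T (c i)) (d j) : ℝ) ^ 2
        = ((K : ℝ) ^ (-b)) ^ 2 * ((inner ℝ (T (c i)) (d j) : ℝ) ^ 2 * (K : ℝ) ^ (2 * b)) := by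
          rw [mul_left_comm, h5, mul_one]
      _ ≤ _ := by gcongr

theorem hsNorm_sub_comp_projFirst_le_rate (T : E →L[ℝ] F) (c : HilbertBasis ℕ ℝ E)
    (d : HilbertBasis ℕ ℝ F) {K : ℕ} (hK : 1 ≤ K) {b : ℝ} (hb : 0 < b)
    (hS : sobolevSum T c d b < ∞) :
    hsNorm (T - T ∘L projFirst c K) ≤
      ENNReal.ofReal ((K : ℝ) ^ (-b) * √(1 + (sobolevSum T c d b).toReal)) := by
  refine le_of_sq_le_sq ((hsNorm_sub_comp_projFirst_sq_le T c d hK hb).trans ?_)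
  rw [ENNReal.ofReal_mul (by positivity), mul_pow]
  gcongr
  rw [← ENNReal.ofReal_pow (by positivity), Real.sq_sqrt (by positivity)]
  refine ENNReal.le_ofReal_iff_toReal_le hS.ne (by positivity) |>.2 ?_
  linarith

theorem enorm_le_hsNorm (T : E →L[ℝ] F) : ‖T‖ₑ ≤ hsNorm T := by
  rcases eq_or_ne (hsNorm T) ∞ with h | h
  · rw [h]; exact le_top
  · rw [← ofReal_norm, ← ENNReal.ofReal_toReal h]
    exact ENNReal.ofReal_le_ofReal (norm_le_of_hsNorm_le ENNReal.toReal_nonneg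
      (ENNReal.ofReal_toReal h).ge)

end EstimatorError

/-! ### Lipschitz stability of the recursion for the moving-average operators -/

section Recursion

variable {H : Type*} [NormedAddCommGroup H] [InnerProductSpace ℝ H]

theorem causalOp_zero (ψ : ℕ → H →L[ℝ] H) : causalOp ψ 0 = ContinuousLinearMap.id ℝ H := by
  rw [causalOp]

theorem causalOp_succ (ψ : ℕ → H →L[ℝ] H) (i : ℕ) :
    causalOp ψ (i + 1) = ∑ j : Fin (i + 1), ψ (j + 1) ∘L causalOp ψ (i - j) := by
  rw [causalOp]

theorem enorm_clm_add_le (S T : H →L[ℝ] H) : ‖S + T‖ₑ ≤ ‖S‖ₑ + ‖T‖ₑ := by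
  simp only [enorm_eq_nnnorm]
  exact_mod_cast nnnorm_add_le S T

/-- The recursion is polynomial, hence only locally Lipschitz: the a priori bound `δ ≤ B` absorbs
the higher powers of `δ`. Only differences are measured in the Hilbert-Schmidt norm, as `φ_0 = I`
need not have a finite one. -/
theorem exists_hsNorm_causalOp_sub_le [CompleteSpace H] (ψ : ℕ → H →L[ℝ] H) {B : ℝ≥0∞}
    (hB : B ≠ ∞) (n : ℕ) :
    ∃ C : ℝ≥0∞, C ≠ ∞ ∧ ∀ (ψ' : ℕ → H →L[ℝ] H) (δ : ℝ≥0∞), δ ≤ B →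
      (∀ j, 1 ≤ j → j ≤ n → hsNorm (ψ' j - ψ j) ≤ δ) →
      ∀ i ≤ n, hsNorm (causalOp ψ' i - causalOp ψ i) ≤ C * δ := by
  induction n with
  | zero =>
    refine ⟨0, by simp, fun ψ' δ _ _ i hi => ?_⟩
    obtain rfl : i = 0 := by omega
    rw [causalOp_zero, causalOp_zero, sub_self, hsNorm_zero]
    exact zero_le
  | succ n ih =>
    obtain ⟨C, hC, ih⟩ := ih
    -- From `ψ'φ' - ψφ = (ψ' - ψ)φ' + ψ(φ' - φ)`, with `‖φ'‖ ≤ ‖φ‖ + C * B` by induction.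
    refine ⟨C + ∑ j : Fin (n + 1), ((‖causalOp ψ (n - j)‖ₑ + C * B) + ‖ψ (j + 1)‖ₑ * C), ?_,
      fun ψ' δ hδ h i hi => ?_⟩
    · refine ENNReal.add_ne_top.2 ⟨hC, (ENNReal.sum_lt_top.2 fun j _ => ?_).ne⟩
      exact ENNReal.add_lt_top.2 ⟨ENNReal.add_lt_top.2 ⟨enorm_lt_top,
        ENNReal.mul_lt_top hC.lt_top hB.lt_top⟩, ENNReal.mul_lt_top enorm_lt_top hC.lt_top⟩
    · have ih' := ih ψ' δ hδ fun j h1 h2 => h j h1 (by omega)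
      rw [add_mul]
      rcases Nat.lt_or_ge n i with hn | hn
      · obtain rfl : i = n + 1 := by omega
        refine le_add_left ?_
        rw [causalOp_succ, causalOp_succ, ← Finset.sum_sub_distrib, Finset.sum_mul]
        refine (hsNorm_sum_le _ _).trans (Finset.sum_le_sum fun j _ => ?_)
        have hj := j.2
        have h1 : hsNorm (causalOp ψ' (n - j) - causalOp ψ (n - j)) ≤ C * δ := ih' _ (by omega)
        have h2 : ψ' (j + 1) ∘L causalOp ψ' (n - j) - ψ (j + 1) ∘L causalOp ψ (n - j) =
            (ψ' (j + 1) - ψ (j + 1)) ∘L causalOp ψ' (n - j) +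
              ψ (j + 1) ∘L (causalOp ψ' (n - j) - causalOp ψ (n - j)) := by
          rw [ContinuousLinearMap.sub_comp, ContinuousLinearMap.comp_sub]
          abel
        have h3 : ‖causalOp ψ' (n - j)‖ₑ ≤ ‖causalOp ψ (n - j)‖ₑ + C * B := by
          calc ‖causalOp ψ' (n - j)‖ₑ
              = ‖causalOp ψ (n - j) + (causalOp ψ' (n - j) - causalOp ψ (n - j))‖ₑ := by
                rw [add_sub_cancel]
            _ ≤ ‖causalOp ψ (n - j)‖ₑ + ‖causalOp ψ' (n - j) - causalOp ψ (n - j)‖ₑ :=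
                enorm_clm_add_le _ _
            _ ≤ _ := by
                gcongr
                exact (enorm_le_hsNorm _).trans (h1.trans (by gcongr))
        rw [h2, add_mul, mul_assoc]
        refine (hsNorm_add_le _ _).trans (add_le_add ?_ ?_)
        · rw [mul_comm]
          exact (hsNorm_comp_le_right _ _).trans
            (mul_le_mul' (h _ (by omega) (by omega)) h3)
        · exact (hsNorm_comp_le_left _ _).trans (mul_le_mul_right h1 _)
      · exact le_add_right (ih' i hn)

end Recursion

/-! ### Row operators and their components -/

section RowOperators

variable {H : Type*} [NormedAddCommGroup H] [InnerProductSpace ℝ H]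

theorem rowOp_apply (ψ : ℕ → H →L[ℝ] H) (L : ℕ) (x : Pow H L) :
    rowOp ψ L x = ∑ i : Fin L, ψ (i + 1) (x i) := by
  simp [rowOp]

theorem component_sub {L : ℕ} (S T : Pow H L →L[ℝ] H) (j : ℕ) :
    component (S - T) j = component S j - component T j := by
  unfold component
  split_ifs <;> simp [ContinuousLinearMap.sub_comp]

theorem component_apply {L : ℕ} (T : Pow H L →L[ℝ] H) {j : ℕ} (hj : 1 ≤ j ∧ j ≤ L) (x : H) :
    component T j x = T (PiLp.single 2 (⟨j - 1, by omega⟩ : Fin L) x) := by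
  rw [component, dif_pos hj]
  rfl

theorem component_rowOp (ψ : ℕ → H →L[ℝ] H) {L j : ℕ} (h1 : 1 ≤ j) (h2 : j ≤ L) :
    component (rowOp ψ L) j = ψ j := by
  ext x
  rw [component_apply _ ⟨h1, h2⟩, rowOp_apply, Finset.sum_eq_single (⟨j - 1, by omega⟩ : Fin L)]
  · simp [Nat.sub_add_cancel h1]
  · intro i _ hi
    simp [hi]
  · simp

theorem norm_rowOp_le (ψ : ℕ → H →L[ℝ] H) (L : ℕ) :
    ‖rowOp ψ L‖ ≤ ∑ i ∈ Finset.range L, ‖ψ (i + 1)‖ := by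
  rw [← Fin.sum_univ_eq_sum_range fun i => ‖ψ (i + 1)‖]
  refine ContinuousLinearMap.opNorm_le_bound _ (by positivity) fun x => ?_
  rw [rowOp_apply, Finset.sum_mul]
  refine (norm_sum_le _ _).trans (Finset.sum_le_sum fun i _ => ?_)
  refine ((ψ (i + 1)).le_opNorm _).trans ?_
  gcongr
  exact PiLp.norm_apply_le x i

theorem hsNorm_component_le [CompleteSpace H] {L : ℕ} (T : Pow H L →L[ℝ] H) (j : ℕ) :
    hsNorm (component T j) ≤ hsNorm T := by
  by_cases hj : 1 ≤ j ∧ j ≤ L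
  · rw [component, dif_pos hj]
    refine (hsNorm_comp_le_right _ _).trans (mul_le_of_le_one_right zero_le ?_)
    rw [← ofReal_norm, ENNReal.ofReal_le_one]
    refine ContinuousLinearMap.opNorm_le_bound _ zero_le_one fun x => ?_
    rw [one_mul]
    exact (PiLp.norm_single 2 (fun _ : Fin L => H) (⟨j - 1, by omega⟩ : Fin L) x).le
  · rw [component, dif_neg hj, hsNorm_zero]
    exact zero_le

/-- The adjoint of a row is a column, whose squared norm splits over its entries. Square summability
of the `ψ_j` then bounds the rows uniformly in `L`. -/
theorem hsNorm_rowOp_sq_le [CompleteSpace H] (ψ : ℕ → H →L[ℝ] H) (L : ℕ) :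
    hsNorm (rowOp ψ L) ^ 2 ≤ ∑ i ∈ Finset.range L, hsNorm (ψ (i + 1)) ^ 2 := by
  obtain ⟨w, d, -⟩ := exists_hilbertBasis ℝ H
  rw [← Fin.sum_univ_eq_sum_range fun i => hsNorm (ψ (i + 1)) ^ 2, ← hsNorm_adjoint, hsNorm_sq d]
  have h : ∀ y : H, ContinuousLinearMap.adjoint (rowOp ψ L) y =
      WithLp.toLp 2 (fun i : Fin L => ContinuousLinearMap.adjoint (ψ (i + 1)) y) := by
    intro y
    refine ext_inner_right ℝ fun x => ?_
    rw [ContinuousLinearMap.adjoint_inner_left, rowOp_apply, inner_sum, PiLp.inner_apply]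
    exact Finset.sum_congr rfl fun i _ => (ContinuousLinearMap.adjoint_inner_left _ _ _).symm
  have h2 : ∀ y : H, ‖ContinuousLinearMap.adjoint (rowOp ψ L) y‖ₑ ^ 2 =
      ∑ i : Fin L, ‖ContinuousLinearMap.adjoint (ψ (i + 1)) y‖ₑ ^ 2 := by
    intro y
    rw [h, ← ofReal_norm, ← ENNReal.ofReal_pow (norm_nonneg _), PiLp.norm_sq_eq_of_L2,
      ENNReal.ofReal_sum_of_nonneg fun i _ => by positivity]
    refine Finset.sum_congr rfl fun i _ => ?_
    rw [ENNReal.ofReal_pow (norm_nonneg _), ofReal_norm]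
  simp_rw [h2]
  rw [Summable.tsum_finsetSum fun i _ => ENNReal.summable]
  refine Finset.sum_le_sum fun i _ => ?_
  rw [← hsNorm_adjoint (ψ _), hsNorm_sq d]

end RowOperators

/-! ### Second moment operators -/

section SecondMoments

theorem eLpNorm_two_sq {Ω E : Type*} [MeasurableSpace Ω] {μ : Measure Ω} [NormedAddCommGroup E]
    {U : Ω → E} : eLpNorm U 2 μ ^ 2 = ∫⁻ ω, ‖U ω‖ₑ ^ 2 ∂μ := by
  have h := eLpNorm_nnreal_pow_eq_lintegral (μ := μ) (f := U) (p := 2) two_ne_zero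
  simpa using h

variable {Ω : Type*} [MeasurableSpace Ω] {μ : Measure Ω}
  {E F : Type*} [NormedAddCommGroup E] [InnerProductSpace ℝ E]
  [NormedAddCommGroup F] [InnerProductSpace ℝ F]

/-- The operator `E[U ⊗ V]`. -/
def crossMom (μ : Measure Ω) (U : Ω → E) (V : Ω → F) : E →L[ℝ] F :=
  ∫ ω, tensor (U ω) (V ω) ∂μ

theorem crossCov_eq_crossMom {U : Ω → E} {V : Ω → F} (hU : ∫ ω, U ω ∂μ = 0)
    (hV : ∫ ω, V ω ∂μ = 0) : crossCov μ U V = crossMom μ U V := by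
  simp [crossCov, crossMom, hU, hV]

theorem integrable_tensor {U : Ω → E} {V : Ω → F} (hU : MemLp U 2 μ) (hV : MemLp V 2 μ) :
    Integrable (fun ω => tensor (U ω) (V ω)) μ := by
  have h1 : Integrable (fun ω => ‖U ω‖ * ‖V ω‖) μ := hU.norm.integrable_mul hV.norm
  refine h1.mono ?_ (.of_forall fun ω => ?_)
  · have hc : Continuous fun p : E × F => tensor p.1 p.2 := by
      exact (InnerProductSpace.rankOne ℝ (E := F) (F := E)).continuous₂.comp continuous_swap
    exact hc.comp_aestronglyMeasurable (f := fun ω => (U ω, V ω)) (hU.1.prodMk hV.1)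
  · rw [tensor, InnerProductSpace.norm_rankOne, norm_mul, norm_norm, norm_norm, mul_comm]

theorem crossMom_congr {U U' : Ω → E} {V V' : Ω → F} (hU : U =ᵐ[μ] U') (hV : V =ᵐ[μ] V') :
    crossMom μ U V = crossMom μ U' V' := by
  refine integral_congr_ae ?_
  filter_upwards [hU, hV] with ω h1 h2
  rw [h1, h2]

theorem memLp_inner {U : Ω → E} (hU : MemLp U 2 μ) (x : E) :
    MemLp (fun ω => (inner ℝ (U ω) x : ℝ)) 2 μ :=
  hU.inner_const x

theorem crossMom_apply {U : Ω → E} {V : Ω → F} (hU : MemLp U 2 μ) (hV : MemLp V 2 μ) (x : E) :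
    crossMom μ U V x = ∫ ω, (inner ℝ (U ω) x : ℝ) • V ω ∂μ :=
  ContinuousLinearMap.integral_apply (integrable_tensor hU hV) x

theorem integrable_inner_smul {U : Ω → E} {V : Ω → F} (hU : MemLp U 2 μ) (hV : MemLp V 2 μ)
    (x : E) : Integrable (fun ω => (inner ℝ (U ω) x : ℝ) • V ω) μ :=
  (integrable_tensor hU hV).apply_continuousLinearMap x

theorem integrable_inner_mul_inner {U : Ω → E} {V : Ω → F} (hU : MemLp U 2 μ) (hV : MemLp V 2 μ)
    (x : E) (y : F) : Integrable (fun ω => (inner ℝ (U ω) x * inner ℝ (V ω) y : ℝ)) μ :=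
  (memLp_inner hU x).integrable_mul (memLp_inner hV y)

theorem crossMom_add_right {U : Ω → E} {V W : Ω → F} (hU : MemLp U 2 μ) (hV : MemLp V 2 μ)
    (hW : MemLp W 2 μ) :
    crossMom μ U (fun ω => V ω + W ω) = crossMom μ U V + crossMom μ U W := by
  rw [crossMom, crossMom, crossMom,
    ← integral_add (integrable_tensor hU hV) (integrable_tensor hU hW)]
  refine integral_congr_ae (.of_forall fun ω => ?_)
  simp [tensor]

theorem crossMom_sum_right {ι : Type*} (s : Finset ι) {U : Ω → E} {V : ι → Ω → F}
    (hU : MemLp U 2 μ) (hV : ∀ i ∈ s, MemLp (V i) 2 μ) :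
    crossMom μ U (fun ω => ∑ i ∈ s, V i ω) = ∑ i ∈ s, crossMom μ U (V i) := by
  simp only [crossMom]
  rw [← integral_finsetSum s fun i hi => integrable_tensor hU (hV i hi)]
  refine integral_congr_ae (.of_forall fun ω => ?_)
  simp [tensor]

variable [CompleteSpace F]

theorem inner_crossMom {U : Ω → E} {V : Ω → F} (hU : MemLp U 2 μ) (hV : MemLp V 2 μ)
    (x : E) (y : F) :
    (inner ℝ (crossMom μ U V x) y : ℝ) = ∫ ω, inner ℝ (U ω) x * inner ℝ (V ω) y ∂μ := by
  rw [crossMom_apply hU hV, real_inner_comm, ← integral_inner (integrable_inner_smul hU hV x)]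
  refine integral_congr_ae (.of_forall fun ω => ?_)
  simp only [inner_smul_right, real_inner_comm y (V ω)]

theorem adjoint_crossMom [CompleteSpace E] {U : Ω → E} {V : Ω → F} (hU : MemLp U 2 μ) (hV : MemLp V 2 μ) :
    ContinuousLinearMap.adjoint (crossMom μ U V) = crossMom μ V U := by
  refine ContinuousLinearMap.ext fun y => ext_inner_right ℝ fun x => ?_
  rw [ContinuousLinearMap.adjoint_inner_left, inner_crossMom hV hU, real_inner_comm,
    inner_crossMom hU hV]
  simp_rw [mul_comm]

theorem crossMom_comp_right {G : Type*} [NormedAddCommGroup G] [InnerProductSpace ℝ G]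
    [CompleteSpace G] (T : F →L[ℝ] G) {U : Ω → E} {V : Ω → F} (hU : MemLp U 2 μ)
    (hV : MemLp V 2 μ) : crossMom μ U (fun ω => T (V ω)) = T ∘L crossMom μ U V := by
  refine ContinuousLinearMap.ext fun x => ?_
  rw [ContinuousLinearMap.comp_apply, crossMom_apply (V := fun ω => T (V ω)) hU
    (T.comp_memLp' hV), crossMom_apply hU hV,
    ← T.integral_comp_comm (integrable_inner_smul hU hV x)]
  simp_rw [map_smul]

/-- Cauchy-Schwarz over `Ω` for each basis vector, then Parseval for `U` under the integral. -/
theorem hsNorm_crossMom_le [CompleteSpace E] (b : HilbertBasis ℕ ℝ E) {U : Ω → E} {V : Ω → F} (hU : MemLp U 2 μ)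
    (hV : MemLp V 2 μ) : hsNorm (crossMom μ U V) ≤ eLpNorm U 2 μ * eLpNorm V 2 μ := by
  refine le_of_sq_le_sq ?_
  have h1 : ∀ i, ‖crossMom μ U V (b i)‖ₑ ^ 2 ≤
      (∫⁻ ω, ‖(inner ℝ (U ω) (b i) : ℝ)‖ₑ ^ 2 ∂μ) * ∫⁻ ω, ‖V ω‖ₑ ^ 2 ∂μ := by
    intro i
    have h2 : ‖crossMom μ U V (b i)‖ₑ ≤ ∫⁻ ω, ‖(inner ℝ (U ω) (b i) : ℝ)‖ₑ * ‖V ω‖ₑ ∂μ := by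
      rw [crossMom_apply hU hV]
      refine (enorm_integral_le_lintegral_enorm _).trans_eq ?_
      simp_rw [enorm_smul]
    have h3 := ENNReal.lintegral_mul_le_Lp_mul_Lq μ (p := 2) (q := 2)
      (by constructor <;> norm_num) (memLp_inner hU (b i)).1.enorm hV.1.enorm
    have h4 := pow_le_pow_left₀ zero_le (h2.trans h3) 2
    have h5 : ∀ a : ℝ≥0∞, (a ^ (1 / 2 : ℝ)) ^ 2 = a := fun a => by
      rw [← ENNReal.rpow_natCast, ← ENNReal.rpow_mul]
      norm_num
    rw [mul_pow, h5, h5] at h4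
    simpa using h4
  rw [hsNorm_sq b, mul_pow, eLpNorm_two_sq, eLpNorm_two_sq]
  refine (ENNReal.tsum_le_tsum h1).trans_eq ?_
  rw [ENNReal.tsum_mul_right, ← lintegral_tsum fun i => (memLp_inner hU (b i)).1.enorm.pow_const 2]
  simp_rw [← enorm_sq_eq_tsum b]

end SecondMoments

/-! ### Moments of the white noise and of the moving average -/

section Processes

theorem IsStationary.eLpNorm_eq {Ω H : Type*} [MeasurableSpace Ω] {μ : Measure Ω} [NormedAddCommGroup H]
    [MeasurableSpace H] [BorelSpace H] {X : ℤ → Ω → H}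
    (h : IsStationary μ X) (k : ℤ) (p : ℝ≥0∞) : eLpNorm (X k) p μ = eLpNorm (X 0) p μ := by
  have h1 : ProbabilityTheory.IdentDistrib (fun ω (_ : Fin 1) => X (0 + k) ω)
      (fun ω (_ : Fin 1) => X 0 ω) μ μ :=
    ⟨aemeasurable_pi_lambda _ fun _ => h.aemeasurable _,
      aemeasurable_pi_lambda _ fun _ => h.aemeasurable _, h.map_eq 1 (fun _ => 0) k⟩
  have h2 := (h1.comp (u := fun x : Fin 1 → H => x 0) (measurable_pi_apply 0)).eLpNorm_eq p
  simpa [Function.comp_def] using h2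

theorem empCov_inner_nonneg {Ω H : Type*} [NormedAddCommGroup H] [InnerProductSpace ℝ H]
    (X : ℤ → Ω → H) {L N : ℕ} (hLN : L ≤ N) (ω : Ω) (x : Pow H L) :
    (0 : ℝ) ≤ inner ℝ (empCov X L N ω x) x := by
  have h : (L : ℝ) ≤ N := by exact_mod_cast hLN
  rw [empCov, smul_apply, sum_apply, inner_smul_left, sum_inner]
  refine mul_nonneg ?_ (Finset.sum_nonneg fun k _ => ?_)
  · simp only [RCLike.conj_to_real, inv_nonneg]
    linarith
  · rw [tensor_apply, inner_smul_left]
    exact mul_self_nonneg _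

theorem memLp_lagVec {Ω H : Type*} [MeasurableSpace Ω] {μ : Measure Ω} [NormedAddCommGroup H]
    {X : ℤ → Ω → H} (hX : ∀ k, MemLp (X k) 2 μ) (L : ℕ) (k : ℤ) : MemLp (lagVec X L k) 2 μ :=
  MemLp.of_eval_piLp fun i => hX (k - (i : ℕ))

variable {Ω : Type*} [MeasurableSpace Ω] {μ : Measure Ω}
  {H : Type*} [NormedAddCommGroup H] [InnerProductSpace ℝ H]

theorem IsWhiteNoise.crossMom_eq {ε : ℤ → Ω → H} (hε : IsWhiteNoise μ ε) (k l : ℤ) :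
    crossMom μ (ε k) (ε l) = if k = l then cov μ (ε 0) else 0 := by
  rw [← crossCov_eq_crossMom (hε.centered k) (hε.centered l)]
  split_ifs with h
  · subst h
    have := hε.weaklyStationary.crossCov_eq k 0 0
    rw [zero_add] at this
    exact this.symm
  · exact hε.uncorrelated k l h

/-- The coefficients `I, β_1, β_2, …` of a moving average. -/
def maCoef (β : ℕ → H →L[ℝ] H) (j : ℕ) : H →L[ℝ] H :=
  if j = 0 then ContinuousLinearMap.id ℝ H else β j

theorem IsFMA.ae_eq_sum {X ε : ℤ → Ω → H} {q : ℕ} {β : ℕ → H →L[ℝ] H} (h : IsFMA μ X ε q β)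
    (k : ℤ) : X k =ᵐ[μ] fun ω => ∑ j ∈ Finset.range (q + 1), maCoef β j (ε (k - j) ω) := by
  filter_upwards [h.eq k] with ω hω
  rw [hω, Finset.sum_range_succ', add_comm]
  congr 1
  · rw [Finset.range_eq_Ico, Finset.sum_Ico_add' (fun j => maCoef β j (ε (k - j) ω)) 0 q 1]
    refine Finset.sum_congr rfl fun j hj => ?_
    rw [maCoef, if_neg]
    exact (Nat.one_le_iff_ne_zero.1 (Finset.mem_Icc.1 hj).1)
  · simp [maCoef]

theorem eLpNorm_lagVec_sq {Ω H : Type*} [MeasurableSpace Ω] {μ : Measure Ω}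
    [NormedAddCommGroup H] [MeasurableSpace H] [BorelSpace H] {X : ℤ → Ω → H} (hX : ∀ k, MemLp (X k) 2 μ)
    (hs : IsStationary μ X) (L : ℕ) (k : ℤ) :
    eLpNorm (lagVec X L k) 2 μ ^ 2 = L * eLpNorm (X 0) 2 μ ^ 2 := by
  have h : ∀ ω, ‖lagVec X L k ω‖ₑ ^ 2 = ∑ i : Fin L, ‖X (k - (i : ℕ)) ω‖ₑ ^ 2 := by
    intro ω
    rw [← ofReal_norm, ← ENNReal.ofReal_pow (norm_nonneg _), PiLp.norm_sq_eq_of_L2,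
      ENNReal.ofReal_sum_of_nonneg fun i _ => by positivity]
    refine Finset.sum_congr rfl fun i _ => ?_
    rw [ENNReal.ofReal_pow (norm_nonneg _), ofReal_norm]
    rfl
  rw [eLpNorm_two_sq]
  simp_rw [h]
  rw [lintegral_finsetSum' _ fun i _ => (hX _).1.enorm.pow_const 2]
  simp_rw [← eLpNorm_two_sq, hs.eLpNorm_eq (k - _) 2]
  simp

section MovingAverage

variable [CompleteSpace H] {X ε : ℤ → Ω → H} {q : ℕ} {β : ℕ → H →L[ℝ] H}

theorem IsFMA.crossMom_noise (h : IsFMA μ X ε q β) (hε : IsWhiteNoise μ ε) (l k : ℤ) :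
    crossMom μ (ε l) (X k) =
      ∑ j ∈ Finset.range (q + 1), maCoef β j ∘L (if l = k - j then cov μ (ε 0) else 0) := by
  have hL2 := hε.weaklyStationary.memLp
  rw [crossMom_congr (ae_eq_refl (ε l)) (h.ae_eq_sum k), crossMom_sum_right
    (V := fun (j : ℕ) ω => maCoef β j (ε (k - j) ω)) _ (hL2 l)
    fun j _ => (maCoef β j).comp_memLp' (hL2 _)]
  refine Finset.sum_congr rfl fun j _ => ?_
  rw [crossMom_comp_right _ (hL2 l) (hL2 _), hε.crossMom_eq]

theorem IsFMA.crossMom_noise_of_lt (h : IsFMA μ X ε q β) (hε : IsWhiteNoise μ ε) {l k : ℤ}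
    (hkl : k < l) : crossMom μ (ε l) (X k) = 0 := by
  rw [h.crossMom_noise hε]
  refine Finset.sum_eq_zero fun j _ => ?_
  rw [if_neg (by omega), ContinuousLinearMap.comp_zero]

theorem IsFMA.crossMom_noise_of_le (h : IsFMA μ X ε q β) (hε : IsWhiteNoise μ ε) (l : ℤ) {m : ℕ}
    (hm : m ≤ q) : crossMom μ (ε l) (X (l + m)) = maCoef β m ∘L cov μ (ε 0) := by
  rw [h.crossMom_noise hε, Finset.sum_eq_single m]
  · rw [if_pos (by omega)]
  · intro j _ hj
    rw [if_neg (by omega), ContinuousLinearMap.comp_zero]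
  · intro hm'
    simp only [Finset.mem_range] at hm'
    omega

theorem IsWhiteNoise.integral_sq_sum (hε : IsWhiteNoise μ ε) {L : ℕ} {t : Fin L → ℤ}
    (ht : Function.Injective t) (y : Fin L → H) :
    ∫ ω, (∑ i, (inner ℝ (ε (t i) ω) (y i) : ℝ)) ^ 2 ∂μ =
      ∑ i, (inner ℝ (cov μ (ε 0) (y i)) (y i) : ℝ) := by
  have hL2 := hε.weaklyStationary.memLp
  simp_rw [sq, Finset.sum_mul_sum]
  rw [integral_finsetSum _ fun i _ => integrable_finsetSum _ fun j _ =>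
    integrable_inner_mul_inner (hL2 _) (hL2 _) _ _]
  refine Finset.sum_congr rfl fun i _ => ?_
  rw [integral_finsetSum _ fun j _ => integrable_inner_mul_inner (hL2 _) (hL2 _) _ _]
  simp_rw [← inner_crossMom (hL2 _) (hL2 _), hε.crossMom_eq]
  rw [Finset.sum_eq_single i]
  · simp
  · intro j _ hj
    rw [if_neg fun h => hj (ht h).symm]
    simp
  · simp

theorem integral_lagVec [IsFiniteMeasure μ] (hX : ∀ k, MemLp (X k) 2 μ)
    (h0 : ∀ k, ∫ ω, X k ω ∂μ = 0) (L : ℕ) (k : ℤ) : ∫ ω, lagVec X L k ω ∂μ = 0 := by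
  ext i
  have h : ∀ i : Fin L, Integrable (fun ω => lagVec X L k ω i) μ :=
    fun i => (hX (k - (i : ℕ))).integrable one_le_two
  rw [eval_integral_piLp h]
  exact h0 _

theorem lagCov_eq_crossMom [IsFiniteMeasure μ] (hX : ∀ k, MemLp (X k) 2 μ)
    (h0 : ∀ k, ∫ ω, X k ω ∂μ = 0) (L : ℕ) :
    lagCov μ X L = crossMom μ (lagVec X L 0) (lagVec X L 0) :=
  crossCov_eq_crossMom (integral_lagVec hX h0 L 0) (integral_lagVec hX h0 L 0)

theorem lagCrossCov_eq_crossMom [IsFiniteMeasure μ] (hX : ∀ k, MemLp (X k) 2 μ)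
    (h0 : ∀ k, ∫ ω, X k ω ∂μ = 0) (L : ℕ) :
    lagCrossCov μ X L = crossMom μ (lagVec X L 0) (X 1) :=
  crossCov_eq_crossMom (integral_lagVec hX h0 L 0) (h0 1)

theorem inner_lagCov [IsFiniteMeasure μ] (hX : ∀ k, MemLp (X k) 2 μ)
    (h0 : ∀ k, ∫ ω, X k ω ∂μ = 0) (L : ℕ) (x : Pow H L) :
    (inner ℝ (lagCov μ X L x) x : ℝ) = ∫ ω, (inner ℝ (lagVec X L 0 ω) x : ℝ) ^ 2 ∂μ := by
  rw [lagCov_eq_crossMom hX h0, inner_crossMom (memLp_lagVec hX L 0) (memLp_lagVec hX L 0)]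
  simp_rw [sq]

/-- The point is a bound free of `L`. For each fixed `j`, `W j` pairs noise at distinct times with
the vectors `β_j^* x_i`, so its second moment has no cross terms; Cauchy-Schwarz over the `q + 1`
values of `j` costs only a constant. -/
theorem IsFMA.inner_lagCov_le [IsFiniteMeasure μ] (h : IsFMA μ X ε q β) (hε : IsWhiteNoise μ ε)
    (hX : ∀ k, MemLp (X k) 2 μ) (h0 : ∀ k, ∫ ω, X k ω ∂μ = 0) (L : ℕ) (x : Pow H L) :
    (inner ℝ (lagCov μ X L x) x : ℝ) ≤
      (q + 1) * ∑ j ∈ Finset.range (q + 1), ‖cov μ (ε 0)‖ * ‖maCoef β j‖ ^ 2 * ‖x‖ ^ 2 := by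
  have hL2 := hε.weaklyStationary.memLp
  let y : ℕ → Fin L → H := fun j i => ContinuousLinearMap.adjoint (maCoef β j) (x i)
  let W : ℕ → Ω → ℝ := fun j ω => ∑ i : Fin L, (inner ℝ (ε (0 - (i : ℕ) - j) ω) (y j i) : ℝ)
  have hW : ∀ j, MemLp (W j) 2 μ := fun j =>
    memLp_finsetSum _ fun i _ => memLp_inner (hL2 _) _
  have hsum : (fun ω => (inner ℝ (lagVec X L 0 ω) x : ℝ)) =ᵐ[μ]
      fun ω => ∑ j ∈ Finset.range (q + 1), W j ω := by
    have h1 : ∀ᵐ ω ∂μ, ∀ i : Fin L, X (0 - (i : ℕ)) ω =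
        ∑ j ∈ Finset.range (q + 1), maCoef β j (ε (0 - (i : ℕ) - j) ω) :=
      ae_all_iff.2 fun i => h.ae_eq_sum _
    filter_upwards [h1] with ω hω
    rw [PiLp.inner_apply, Finset.sum_comm]
    refine Finset.sum_congr rfl fun i _ => ?_
    simp only [lagVec, hω, sum_inner]
    exact Finset.sum_congr rfl fun j _ =>
      (ContinuousLinearMap.adjoint_inner_right _ _ _).symm
  have hWle : ∀ j, ∫ ω, W j ω ^ 2 ∂μ ≤ ‖cov μ (ε 0)‖ * ‖maCoef β j‖ ^ 2 * ‖x‖ ^ 2 := by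
    intro j
    rw [hε.integral_sq_sum (t := fun i : Fin L => 0 - ((i : ℕ) : ℤ) - j)
      (fun a b hab => Fin.ext (by simp only at hab; omega)), PiLp.norm_sq_eq_of_L2, Finset.mul_sum]
    refine Finset.sum_le_sum fun i _ => ?_
    have h2 : ‖y j i‖ ≤ ‖maCoef β j‖ * ‖x i‖ := by
      refine (ContinuousLinearMap.le_opNorm _ _).trans_eq ?_
      rw [LinearIsometryEquiv.norm_map]
    calc (inner ℝ (cov μ (ε 0) (y j i)) (y j i) : ℝ)
        ≤ ‖cov μ (ε 0) (y j i)‖ * ‖y j i‖ := real_inner_le_norm _ _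
      _ ≤ ‖cov μ (ε 0)‖ * ‖y j i‖ * ‖y j i‖ := by
          gcongr
          exact ContinuousLinearMap.le_opNorm _ _
      _ = ‖cov μ (ε 0)‖ * ‖y j i‖ ^ 2 := by ring
      _ ≤ ‖cov μ (ε 0)‖ * (‖maCoef β j‖ * ‖x i‖) ^ 2 := by gcongr
      _ = _ := by ring
  rw [inner_lagCov hX h0]
  calc ∫ ω, (inner ℝ (lagVec X L 0 ω) x : ℝ) ^ 2 ∂μ
      = ∫ ω, (∑ j ∈ Finset.range (q + 1), W j ω) ^ 2 ∂μ := by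
        refine integral_congr_ae ?_
        filter_upwards [hsum] with ω hω
        rw [hω]
    _ ≤ ∫ ω, (q + 1) * ∑ j ∈ Finset.range (q + 1), W j ω ^ 2 ∂μ := by
        refine integral_mono (memLp_finsetSum _ fun j _ => hW j).integrable_sq
          ((integrable_finsetSum _ fun j _ => (hW j).integrable_sq).const_mul _) fun ω => ?_
        have := sq_sum_le_card_mul_sum_sq (s := Finset.range (q + 1)) (f := fun j => W j ω)
        simpa using this
    _ = (q + 1) * ∑ j ∈ Finset.range (q + 1), ∫ ω, W j ω ^ 2 ∂μ := by
        rw [integral_const_mul, integral_finsetSum _ fun j _ => (hW j).integrable_sq]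
    _ ≤ _ := by
        gcongr with j
        exact hWle j

end MovingAverage

/-! ### The inverted representation -/

section Invertible

variable {X ε : ℤ → Ω → H} {q : ℕ} {β ψ : ℕ → H →L[ℝ] H}

/-- The remainder `∑_{j > n} ψ_j(X_{k-j})` of the inverted representation. -/
def invRem (X ε : ℤ → Ω → H) (ψ : ℕ → H →L[ℝ] H) (k : ℤ) (n : ℕ) (ω : Ω) : H :=
  X k ω - ε k ω - ∑ j ∈ Finset.range n, ψ (j + 1) (X (k - (j + 1)) ω)

/-- The remainder is defined as a finite combination, so this needs no convergence of the series. -/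
theorem memLp_invRem (hX : ∀ k, MemLp (X k) 2 μ) (hε : ∀ k, MemLp (ε k) 2 μ) (k : ℤ) (n : ℕ) :
    MemLp (invRem X ε ψ k n) 2 μ :=
  ((hX k).sub (hε k)).sub
    (memLp_finsetSum _ fun j _ => (ψ (j + 1)).comp_memLp' (hX _))

theorem crossMom_eq_add_invRem [CompleteSpace H] {E : Type*} [NormedAddCommGroup E] [InnerProductSpace ℝ E]
    [CompleteSpace E] {U : Ω → E} (hU : MemLp U 2 μ) (hX : ∀ k, MemLp (X k) 2 μ)
    (hε : ∀ k, MemLp (ε k) 2 μ) (k : ℤ) (n : ℕ) :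
    crossMom μ U (X k) = crossMom μ U (ε k) + crossMom μ U (invRem X ε ψ k n) +
      ∑ j ∈ Finset.range n, ψ (j + 1) ∘L crossMom μ U (X (k - (j + 1))) := by
  have h1 : ∀ j : ℕ, MemLp (fun ω => ψ (j + 1) (X (k - (j + 1)) ω)) 2 μ :=
    fun j => (ψ (j + 1)).comp_memLp' (hX _)
  have h2 : X k = fun ω => ε k ω + invRem X ε ψ k n ω +
      ∑ j ∈ Finset.range n, ψ (j + 1) (X (k - (j + 1)) ω) := by
    ext ω
    rw [invRem]
    abel
  conv_lhs => rw [h2]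
  rw [crossMom_add_right (V := fun ω => ε k ω + invRem X ε ψ k n ω) hU ((hε k).add (memLp_invRem hX hε k n)) (memLp_finsetSum _ fun j _ => h1 j),
    crossMom_add_right hU (hε k) (memLp_invRem hX hε k n), crossMom_sum_right _ hU fun j _ => h1 j]
  congr 1
  exact Finset.sum_congr rfl fun j _ => crossMom_comp_right _ hU (hX _)

/-- An operator is determined by its composition with an injective covariance operator. -/
theorem eq_of_comp_cov_eq [CompleteSpace H] {U : Ω → H} (hU : MemLp U 2 μ) (h0 : ∫ ω, U ω ∂μ = 0)
    (hinj : Function.Injective (cov μ U)) {S T : H →L[ℝ] H}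
    (h : S ∘L cov μ U = T ∘L cov μ U) : S = T := by
  have hadj : ContinuousLinearMap.adjoint (cov μ U) = cov μ U := by
    rw [cov, crossCov_eq_crossMom h0 h0, adjoint_crossMom hU hU]
  -- As the covariance is self-adjoint, taking adjoints moves it to the left, where injectivity
  -- cancels it.
  have h1 := congrArg ContinuousLinearMap.adjoint h
  rw [ContinuousLinearMap.adjoint_comp, ContinuousLinearMap.adjoint_comp, hadj] at h1
  refine ContinuousLinearMap.adjoint.injective (ContinuousLinearMap.ext fun x => hinj ?_)
  exact DFunLike.congr_fun h1 x

/-- A truncated Yule-Walker equation. The noise term drops out because `X_0, X_{-1}, …` involve no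
noise later than time `0`. -/
theorem IsFMA.lagCrossCov_eq [CompleteSpace H] [MeasurableSpace H] [IsFiniteMeasure μ] (hfma : IsFMA μ X ε q β)
    (h : IsInvertible μ X ε ψ) (hε : IsWhiteNoise μ ε) (hX : ∀ k, MemLp (X k) 2 μ) (L : ℕ) :
    lagCrossCov μ X L =
      rowOp ψ L ∘L lagCov μ X L + crossMom μ (lagVec X L 0) (invRem X ε ψ 1 L) := by
  have hL2 := hε.weaklyStationary.memLp
  have hU := memLp_lagVec hX L 0
  have h1 : crossMom μ (lagVec X L 0) (ε 1) = 0 := by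
    refine ContinuousLinearMap.ext fun x => ext_inner_right ℝ fun y => ?_
    rw [inner_crossMom hU (hL2 1)]
    simp_rw [PiLp.inner_apply, Finset.sum_mul]
    have h3 : ∀ i : Fin L, MemLp (fun ω => lagVec X L 0 ω i) 2 μ := fun i => hX (0 - (i : ℕ))
    rw [integral_finsetSum _ fun i _ => integrable_inner_mul_inner (h3 i) (hL2 1) _ _]
    rw [zero_apply, inner_zero_left]
    refine Finset.sum_eq_zero fun i _ => ?_
    have h2 := inner_crossMom (hL2 1) (hX (0 - (i : ℕ))) y (x i)
    rw [hfma.crossMom_noise_of_lt hε (by omega), zero_apply, inner_zero_left] at h2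
    rw [h2]
    exact integral_congr_ae (.of_forall fun ω => mul_comm _ _)
  rw [lagCrossCov_eq_crossMom hX h.centered, lagCov_eq_crossMom hX h.centered,
    crossMom_eq_add_invRem (ψ := ψ) hU hX hL2 1 L, h1, zero_add, add_comm,
    ← crossMom_comp_right _ hU hU]
  congr 1
  simp_rw [rowOp_apply]
  rw [crossMom_sum_right (V := fun (i : Fin L) ω => ψ (i + 1) (lagVec X L 0 ω i)) _ hU
      fun i _ => (ψ (i + 1)).comp_memLp' (hX (0 - (i : ℕ))),
    ← Fin.sum_univ_eq_sum_range fun j => ψ (j + 1) ∘L crossMom μ (lagVec X L 0) (X (1 - (j + 1)))]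
  refine Finset.sum_congr rfl fun i _ => ?_
  rw [show (1 : ℤ) - ((i : ℕ) + 1) = 0 - (i : ℕ) by ring]
  exact (crossMom_comp_right _ hU (hX _)).symm

variable [MeasurableSpace H] [BorelSpace H]

/-- The triangle inequality and stationarity bound the partial sums of the tail; Fatou's lemma
passes to their almost sure limit. -/
theorem IsInvertible.eLpNorm_invRem_le (h : IsInvertible μ X ε ψ) (hX : ∀ k, MemLp (X k) 2 μ)
    (hψ : Summable fun i : ℕ => ‖ψ (i + 1)‖) (k : ℤ) (n : ℕ) :
    eLpNorm (invRem X ε ψ k n) 2 μ ≤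
      ENNReal.ofReal (∑' i : ℕ, ‖ψ (n + 1 + i)‖) * eLpNorm (X 0) 2 μ := by
  have hsum : Summable fun i : ℕ => ‖ψ (n + 1 + i)‖ := by
    refine ((summable_nat_add_iff n).2 hψ).congr fun i => ?_
    rw [show i + n + 1 = n + 1 + i by omega]
  let f : ℕ → Ω → H := fun m =>
    ∑ j ∈ Finset.range m, fun ω => ψ (j + n + 1) (X (k - ((j + n : ℕ) + 1)) ω)
  have hmeas : ∀ j : ℕ, AEStronglyMeasurable
      (fun ω => ψ (j + n + 1) (X (k - ((j + n : ℕ) + 1)) ω)) μ :=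
    fun j => ((ψ (j + n + 1)).comp_memLp' (hX _)).1
  have hlim : ∀ᵐ ω ∂μ, Tendsto (fun m => f m ω) atTop (𝓝 (invRem X ε ψ k n ω)) := by
    filter_upwards [h.eq k] with ω hω
    have h1 := (hasSum_nat_add_iff (f := fun j : ℕ => ψ (j + 1) (X (k - (j + 1)) ω))
      (g := invRem X ε ψ k n ω) n).2 (by rwa [invRem, sub_add_cancel])
    refine h1.tendsto_sum_nat.congr fun m => ?_
    simp only [f, Finset.sum_apply]
  refine (Lp.eLpNorm_lim_le_liminf_eLpNorm (f := f)
    (fun m => Finset.aestronglyMeasurable_sum _ fun j _ => hmeas j) _ hlim).trans ?_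
  refine Filter.liminf_le_of_le (by isBoundedDefault) fun a ha => ?_
  obtain ⟨m, hm⟩ := ha.exists
  refine hm.trans ((eLpNorm_sum_le (fun j _ => hmeas j) one_le_two).trans ?_)
  calc ∑ j ∈ Finset.range m,
        eLpNorm (fun ω => ψ (j + n + 1) (X (k - ((j + n : ℕ) + 1)) ω)) 2 μ
      ≤ ∑ j ∈ Finset.range m, ENNReal.ofReal ‖ψ (n + 1 + j)‖ * eLpNorm (X 0) 2 μ := by
        refine Finset.sum_le_sum fun j _ => ?_
        rw [← h.stationary.eLpNorm_eq (k - ((j + n : ℕ) + 1)), show n + 1 + j = j + n + 1 by omega]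
        exact eLpNorm_le_mul_eLpNorm_of_ae_le_mul
          (.of_forall fun ω => (ψ (j + n + 1)).le_opNorm _) 2
    _ = ENNReal.ofReal (∑ j ∈ Finset.range m, ‖ψ (n + 1 + j)‖) * eLpNorm (X 0) 2 μ := by
        rw [← Finset.sum_mul, ENNReal.ofReal_sum_of_nonneg fun _ _ => norm_nonneg _]
    _ ≤ _ := by
        gcongr
        exact hsum.sum_le_tsum _ fun _ _ => norm_nonneg _

variable [CompleteSpace H]

theorem IsInvertible.tendsto_crossMom_invRem (h : IsInvertible μ X ε ψ)
    (hX : ∀ k, MemLp (X k) 2 μ) (hε : ∀ k, MemLp (ε k) 2 μ)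
    (hψ : Summable fun i : ℕ => ‖ψ (i + 1)‖) (d : HilbertBasis ℕ ℝ H) (l k : ℤ) :
    Tendsto (fun n => crossMom μ (ε l) (invRem X ε ψ k n)) atTop (𝓝 0) := by
  have hσ : eLpNorm (ε l) 2 μ * eLpNorm (X 0) 2 μ ≠ ∞ := ENNReal.mul_ne_top (hε l).2.ne (hX 0).2.ne
  have htail : Tendsto (fun n : ℕ => ∑' i : ℕ, ‖ψ (n + 1 + i)‖) atTop (𝓝 0) := by
    refine (tendsto_sum_nat_add fun i : ℕ => ‖ψ (i + 1)‖).congr fun n => ?_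
    refine tsum_congr fun i => ?_
    rw [show i + n + 1 = n + 1 + i by omega]
  refine squeeze_zero_norm (a := fun n => (∑' i : ℕ, ‖ψ (n + 1 + i)‖) *
    (eLpNorm (ε l) 2 μ * eLpNorm (X 0) 2 μ).toReal) (fun n => ?_) ?_
  · have hnn : 0 ≤ ∑' i : ℕ, ‖ψ (n + 1 + i)‖ := tsum_nonneg fun _ => norm_nonneg _
    refine norm_le_of_hsNorm_le (by positivity) ?_
    refine (hsNorm_crossMom_le d (hε l) (memLp_invRem hX hε k n)).trans ?_
    rw [ENNReal.ofReal_mul hnn, ENNReal.ofReal_toReal hσ, mul_left_comm]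
    gcongr
    exact h.eLpNorm_invRem_le hX hψ k n
  · simpa using htail.mul_const (eLpNorm (ε l) 2 μ * eLpNorm (X 0) 2 μ).toReal

/-- Both representations of `X_{m+1}` are paired with `ε_0`. Terms with `j > m` involve `X` at
negative times and vanish, and the injective noise covariance is cancelled. -/
theorem IsInvertible.maCoef_eq (h : IsInvertible μ X ε ψ) (hfma : IsFMA μ X ε q β)
    (hε : IsWhiteNoise μ ε) (hX : ∀ k, MemLp (X k) 2 μ) (hinj : Function.Injective (cov μ (ε 0)))
    (hψ : Summable fun i : ℕ => ‖ψ (i + 1)‖) (d : HilbertBasis ℕ ℝ H) {m : ℕ} (hm : m + 1 ≤ q) :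
    maCoef β (m + 1) = ∑ j : Fin (m + 1), ψ (j + 1) ∘L maCoef β (m - j) := by
  have hL2 := hε.weaklyStationary.memLp
  refine eq_of_comp_cov_eq (hL2 0) (hε.centered 0) hinj ?_
  have h1 : ∀ n, m + 1 ≤ n → crossMom μ (ε 0) (invRem X ε ψ (m + 1 : ℕ) n) =
      maCoef β (m + 1) ∘L cov μ (ε 0) -
        (∑ j : Fin (m + 1), ψ (j + 1) ∘L maCoef β (m - j)) ∘L cov μ (ε 0) := by
    intro n hn
    have h2 := crossMom_eq_add_invRem (ψ := ψ) (hL2 0) hX hL2 (m + 1 : ℕ) n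
    have h3 := hfma.crossMom_noise_of_le hε 0 hm
    rw [zero_add] at h3
    have h4 : ∑ j ∈ Finset.range n, ψ (j + 1) ∘L
        crossMom μ (ε 0) (X (((m + 1 : ℕ) : ℤ) - (j + 1))) =
        (∑ j : Fin (m + 1), ψ (j + 1) ∘L maCoef β (m - j)) ∘L cov μ (ε 0) := by
      rw [Fin.sum_univ_eq_sum_range fun j => ψ (j + 1) ∘L maCoef β (m - j),
        ContinuousLinearMap.finsetSum_comp,
        ← Finset.sum_subset (Finset.range_mono hn)]
      · refine Finset.sum_congr rfl fun j hj => ?_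
        have hj' : j ≤ m := by simpa [Nat.lt_succ_iff] using hj
        have h5 := hfma.crossMom_noise_of_le hε 0 (m := m - j) (by omega)
        rw [show ((m + 1 : ℕ) : ℤ) - (j + 1) = 0 + ((m - j : ℕ) : ℤ) by omega, h5,
          ContinuousLinearMap.comp_assoc]
      · intro j _ hj
        have hj' : m < j := by simpa [Nat.lt_succ_iff] using hj
        rw [hfma.crossMom_noise_of_lt hε (by omega), ContinuousLinearMap.comp_zero]
    rw [h3, h4, hε.crossMom_eq, if_neg (by omega), zero_add] at h2
    rw [h2, add_sub_cancel_right]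
  -- The difference equals the remainder moment for every `n ≥ m + 1`: a constant sequence that
  -- tends to `0`.
  refine sub_eq_zero.1 (tendsto_nhds_unique ?_
    (h.tendsto_crossMom_invRem hX hL2 hψ d 0 (m + 1 : ℕ)))
  refine tendsto_const_nhds.congr' ?_
  filter_upwards [eventually_ge_atTop (m + 1)] with n hn
  exact (h1 n hn).symm

theorem IsInvertible.causalOp_eq (h : IsInvertible μ X ε ψ) (hfma : IsFMA μ X ε q β)
    (hε : IsWhiteNoise μ ε) (hX : ∀ k, MemLp (X k) 2 μ) (hinj : Function.Injective (cov μ (ε 0)))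
    (hψ : Summable fun i : ℕ => ‖ψ (i + 1)‖) (d : HilbertBasis ℕ ℝ H) {m : ℕ} (hm : m ≤ q) :
    causalOp ψ m = maCoef β m := by
  induction m using Nat.strong_induction_on with
  | _ m ih =>
    cases m with
    | zero => rw [causalOp_zero, maCoef, if_pos rfl]
    | succ m =>
      rw [causalOp_succ, h.maCoef_eq hfma hε hX hinj hψ d hm]
      exact Finset.sum_congr rfl fun j _ => by rw [ih (m - j) (by omega) (by omega)]

/-- The factor `√L` is the growth of the `L²` norm of `X^{[L]}`, whose `L` coordinates have equal
norms. -/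
theorem IsInvertible.hsNorm_crossMom_invRem_le (h : IsInvertible μ X ε ψ)
    (hX : ∀ k, MemLp (X k) 2 μ) (hε : ∀ k, MemLp (ε k) 2 μ)
    (hψ : Summable fun i : ℕ => ‖ψ (i + 1)‖) {L : ℕ} (c : HilbertBasis ℕ ℝ (Pow H L)) :
    hsNorm (crossMom μ (lagVec X L 0) (invRem X ε ψ 1 L)) ≤
      ENNReal.ofReal ((eLpNorm (X 0) 2 μ).toReal ^ 2 * (√L * ∑' i : ℕ, ‖ψ (L + 1 + i)‖)) := by
  have hnn : 0 ≤ ∑' i : ℕ, ‖ψ (L + 1 + i)‖ := tsum_nonneg fun _ => norm_nonneg _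
  have hσ : ENNReal.ofReal (eLpNorm (X 0) 2 μ).toReal = eLpNorm (X 0) 2 μ :=
    ENNReal.ofReal_toReal (hX 0).2.ne
  have h1 : eLpNorm (lagVec X L 0) 2 μ ≤ ENNReal.ofReal (√L) * eLpNorm (X 0) 2 μ := by
    refine le_of_sq_le_sq ?_
    rw [eLpNorm_lagVec_sq hX h.stationary, mul_pow, ← ENNReal.ofReal_pow (by positivity),
      Real.sq_sqrt (by positivity), ENNReal.ofReal_natCast]
  refine (hsNorm_crossMom_le c (memLp_lagVec hX L 0) (memLp_invRem hX hε 1 L)).trans ?_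
  refine (mul_le_mul' h1 (h.eLpNorm_invRem_le hX hψ 1 L)).trans_eq ?_
  rw [ENNReal.ofReal_mul (by positivity), ENNReal.ofReal_mul (by positivity),
    ENNReal.ofReal_pow (by positivity), hσ]
  ring

end Invertible

end Processes

/-! ### Rates -/

section Rates

/-- Discarding two events of probability at most `δ / 2` reduces the claim to a deterministic
implication at each `ω`. -/
theorem IsBigOInProb.of_imp {Ω : Type*} [MeasurableSpace Ω] {μ : Measure Ω}
    {Y Z W : ℕ → Ω → ℝ≥0∞} {r s t : ℕ → ℝ} (hY : IsBigOInProb μ Y r) (hZ : IsBigOInProb μ Z s)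
    (h : ∀ a b : ℝ, 0 < a → 0 < b → ∃ M : ℝ, 0 < M ∧ ∀ᶠ N in atTop, ∀ ω,
      Y N ω ≤ ENNReal.ofReal (a * r N) → Z N ω ≤ ENNReal.ofReal (b * s N) →
        W N ω ≤ ENNReal.ofReal (M * t N)) : IsBigOInProb μ W t := by
  intro δ hδ
  obtain ⟨a, ha, hYa⟩ := hY (δ / 2) (by positivity)
  obtain ⟨b, hb, hZb⟩ := hZ (δ / 2) (by positivity)
  obtain ⟨M, hM, hW⟩ := h a b ha hb
  refine ⟨M, hM, ?_⟩
  filter_upwards [hYa, hZb, hW] with N h1 h2 h3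
  calc μ {ω | ENNReal.ofReal (M * t N) < W N ω}
      ≤ μ ({ω | ENNReal.ofReal (a * r N) < Y N ω} ∪ {ω | ENNReal.ofReal (b * s N) < Z N ω}) := by
        refine measure_mono fun ω hω => ?_
        by_contra hcon
        simp only [Set.mem_union, Set.mem_ofPred_eq, not_or, not_lt] at hcon
        exact absurd (h3 ω hcon.1 hcon.2) (not_le.2 hω)
    _ ≤ ENNReal.ofReal (δ / 2) + ENNReal.ofReal (δ / 2) :=
        (measure_union_le _ _).trans (add_le_add h1 h2)
    _ = ENNReal.ofReal δ := by
        rw [← ENNReal.ofReal_add (by positivity) (by positivity), add_halves]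

/-- Here `κ, l, g, m, s` stand for `K, λ_K, Λ_K, L, N^{-1/2}`. The inequalities `1 ≤ κ`, `1 ≤ B * g`
and `l ≤ B` supply the factors missing from the single rate condition `hA`. -/
theorem rate_bounds {κ b l g m s A B : ℝ} (hκ : 1 ≤ κ) (hl : 0 < l) (hlB : l ≤ B) (hg : 0 < g)
    (hBg : 1 ≤ B * g) (hm : 1 ≤ m) (hs : 0 ≤ s) (hA : κ ^ (1 + b) * l⁻¹ * g * m ^ 2 * s ≤ A) :
    κ * g * m ^ 2 * s * l⁻¹ ≤ A * κ ^ (-b) ∧ m ^ 2 * s * l⁻¹ ≤ A * B * κ ^ (-b) ∧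
      g * m ^ 2 * s ≤ A * B * κ ^ (-b) := by
  have hκ0 : 0 < κ := by linarith
  have hB : 0 < B := hl.trans_le hlB
  have h1 : κ * g * m ^ 2 * s * l⁻¹ ≤ A * κ ^ (-b) := by
    calc κ * g * m ^ 2 * s * l⁻¹ = κ ^ (1 + b) * l⁻¹ * g * m ^ 2 * s * κ ^ (-b) := by
          rw [Real.rpow_add hκ0, Real.rpow_one, Real.rpow_neg hκ0.le]
          have : κ ^ b ≠ 0 := by positivity
          field_simp
      _ ≤ _ := by gcongr
  have h2 : g * m ^ 2 * s * l⁻¹ ≤ A * κ ^ (-b) := by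
    refine le_trans ?_ h1
    rw [show κ * g * m ^ 2 * s * l⁻¹ = κ * (g * m ^ 2 * s * l⁻¹) by ring]
    exact le_mul_of_one_le_left (by positivity) hκ
  refine ⟨h1, ?_, ?_⟩
  · calc m ^ 2 * s * l⁻¹ ≤ B * g * (m ^ 2 * s * l⁻¹) := le_mul_of_one_le_left (by positivity) hBg
      _ = B * (g * m ^ 2 * s * l⁻¹) := by ring
      _ ≤ B * (A * κ ^ (-b)) := by gcongr
      _ = _ := by ring
  · calc g * m ^ 2 * s = l * (g * m ^ 2 * s * l⁻¹) := by field_simp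
      _ ≤ B * (A * κ ^ (-b)) := by gcongr
      _ = _ := by ring

theorem inv_gap_le_gapSup (lam : ℕ → ℝ) {K j : ℕ} (hj : j < K) :
    (lam j - lam (j + 1))⁻¹ ≤ gapSup lam K :=
  le_ciSup (f := fun j : Fin K => (lam j - lam (j + 1))⁻¹) (Set.finite_range _).bddAbove ⟨j, hj⟩

theorem rpow_three_halves_le_sq {m : ℝ} (hm : 1 ≤ m) : m ^ (3 / 2 : ℝ) ≤ m ^ 2 := by
  rw [← Real.rpow_natCast]
  exact Real.rpow_le_rpow_of_exponent_le hm (by norm_num)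

theorem sqrt_mul_rpow_three_halves {m : ℝ} (hm : 1 ≤ m) : √m * m ^ (3 / 2 : ℝ) = m ^ 2 := by
  rw [Real.sqrt_eq_rpow, ← Real.rpow_add (by linarith), ← Real.rpow_natCast]
  norm_num

theorem exists_hsNorm_rowOp_le {H : Type*} [NormedAddCommGroup H] [InnerProductSpace ℝ H]
    [CompleteSpace H] {ψ : ℕ → H →L[ℝ] H} (hψ : ∑' i : ℕ, hsNorm (ψ (i + 1)) ^ 2 < ∞) :
    ∃ C : ℝ, 0 ≤ C ∧ ∀ L, hsNorm (rowOp ψ L) ≤ ENNReal.ofReal C := by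
  refine ⟨√(∑' i : ℕ, hsNorm (ψ (i + 1)) ^ 2).toReal, by positivity, fun L => le_of_sq_le_sq ?_⟩
  rw [← ENNReal.ofReal_pow (by positivity), Real.sq_sqrt ENNReal.toReal_nonneg,
    ENNReal.ofReal_toReal hψ.ne]
  exact (hsNorm_rowOp_sq_le ψ L).trans (ENNReal.sum_le_tsum _)

theorem eventually_le_of_isLittleO {L : ℕ → ℕ}
    (hL : (fun N => (L N : ℝ)) =o[atTop] fun N : ℕ => (N : ℝ) ^ (1 / 3 : ℝ)) :
    ∀ᶠ N in atTop, L N ≤ N := by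
  filter_upwards [hL.bound zero_lt_one, eventually_ge_atTop 1] with N h hN
  have hN' : (1 : ℝ) ≤ N := by exact_mod_cast hN
  rw [one_mul, Real.norm_of_nonneg (by positivity), Real.norm_of_nonneg (by positivity)] at h
  have h2 : (N : ℝ) ^ (1 / 3 : ℝ) ≤ (N : ℝ) ^ (1 : ℝ) :=
    Real.rpow_le_rpow_of_exponent_le hN' (by norm_num)
  rw [Real.rpow_one] at h2
  exact_mod_cast h.trans h2

theorem IsEigenSystem.lt_of_ne {E : Type*} [NormedAddCommGroup E] [InnerProductSpace ℝ E]
    {A : E →L[ℝ] E} {lam : ℕ → ℝ} {c : HilbertBasis ℕ ℝ E} (h : IsEigenSystem A lam c)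
    (hlam : ∀ j, lam j ≠ lam (j + 1)) (j : ℕ) : lam (j + 1) < lam j :=
  lt_of_le_of_ne (h.antitone (Nat.le_succ j)) (hlam j).symm

/-- The error of the estimator `rowHat` at a fixed sample size, in terms of the errors of the
empirical operators and of the size of the tuning parameters. -/
theorem hsNorm_rowHat_sub_le {Ω : Type*} [MeasurableSpace Ω] {μ : Measure Ω}
    {H : Type*} [NormedAddCommGroup H] [InnerProductSpace ℝ H] [CompleteSpace H]
    {X : ℤ → Ω → H} {ψ : ℕ → H →L[ℝ] H} {L N K : ℕ} {ω : Ω} (hLN : L ≤ N) (hL : 1 ≤ L)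
    {lam mu : ℕ → ℝ} {c e : HilbertBasis ℕ ℝ (Pow H L)}
    (hc : IsEigenSystem (lagCov μ X L) lam c) (he : IsEigenSystem (empCov X L N ω) mu e)
    (hlam0 : ∀ j, 0 ≤ lam j) (hlam : ∀ j, lam j ≠ lam (j + 1)) {R : Pow H L →L[ℝ] H}
    (hD : lagCrossCov μ X L = rowOp ψ L ∘L lagCov μ X L + R) {θ : ℝ} (hθ : 0 < θ) (hK : 1 ≤ K)
    {A B b s σ P Q τ x y : ℝ} (hB : lam 0 ≤ B) (hs : 0 ≤ s) (hσ : 0 ≤ σ) (hP : 0 ≤ P)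
    (hQ : 0 ≤ Q) (hτ : 0 ≤ τ) (hx : 0 ≤ x) (hy : 0 ≤ y)
    (hA : (K : ℝ) ^ (1 + b) * (lam (K - 1))⁻¹ * gapSup lam K * (L : ℝ) ^ 2 * s ≤ A)
    (hψP : ‖rowOp ψ L‖ ≤ P) (hψQ : hsNorm (rowOp ψ L) ≤ ENNReal.ofReal Q)
    (hR : hsNorm R ≤ ENNReal.ofReal (σ * (√L * τ)))
    (hτ_le : τ ≤ K * gapSup lam K * (L : ℝ) ^ (3 / 2 : ℝ) * s)
    (hθ_le : θ ≤ K * gapSup lam K * (L : ℝ) ^ 2 * s)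
    (hsmall : x * (A * B * (K : ℝ) ^ (-b)) ≤ 1 / 2)
    (hC : hsNorm (empCov X L N ω - lagCov μ X L) ≤
      ENNReal.ofReal (x * ((L : ℝ) ^ (3 / 2 : ℝ) * s)))
    (hDx : hsNorm (empCrossCov X L N ω - lagCrossCov μ X L) ≤ ENNReal.ofReal (y * (L * s))) :
    hsNorm (rowHat X L N K θ e ω - rowOp ψ L) ≤
      ENNReal.ofReal (2 * (y * (A * B) + σ * A + P * (x * (A * B)) + A * Q + P * (x * (A * B))) *
        (K : ℝ) ^ (-b)) + hsNorm (rowOp ψ L - rowOp ψ L ∘L projFirst c K) := by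
  set Λ := gapSup lam K with hΛdef
  set l := lam (K - 1) with hldef
  set κ := (K : ℝ) ^ (-b) with hκdef
  have hK1 : K - 1 + 1 = K := Nat.sub_add_cancel hK
  have hgap : 0 < l - lam K := by
    have := hc.lt_of_ne hlam (K - 1)
    rw [hK1] at this
    exact sub_pos.2 this
  have hl : 0 < l := by have := hlam0 K; linarith
  have hgap_le : (l - lam K)⁻¹ ≤ Λ := by
    have := inv_gap_le_gapSup lam (Nat.sub_lt hK one_pos)
    rwa [hK1] at this
  have hΛ : 0 < Λ := (inv_pos.2 hgap).trans_le hgap_le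
  have hlB : l ≤ B := (hc.antitone (Nat.zero_le _)).trans hB
  -- The first gap is at most `λ_1 ≤ B`, so `Λ` is at least `1 / B`.
  have hBΛ : 1 ≤ B * Λ := by
    have h1 := hc.lt_of_ne hlam 0
    have h2 := inv_gap_le_gapSup lam (K := K) (j := 0) hK
    have h3 : lam 0 - lam (0 + 1) ≤ B := by have := hlam0 (0 + 1); linarith
    have h4 : 0 < lam 0 - lam (0 + 1) := sub_pos.2 h1
    calc (1 : ℝ) = (lam 0 - lam (0 + 1)) * (lam 0 - lam (0 + 1))⁻¹ := (mul_inv_cancel₀ h4.ne').symm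
      _ ≤ B * Λ := mul_le_mul h3 h2 (by positivity) (by linarith)
  have hL' : (1 : ℝ) ≤ L := by exact_mod_cast hL
  have hK' : (1 : ℝ) ≤ K := by exact_mod_cast hK
  obtain ⟨r1, r2, r3⟩ := rate_bounds hK' hl hlB hΛ hBΛ hL' hs hA
  have hL32 := rpow_three_halves_le_sq hL'
  have hB0 : 0 < B := hl.trans_le hlB
  -- With indices from `0`, `l` is `λ_K` and `lam K` is `λ_{K+1}`; `Λ⁻¹` serves as the gap `g` in
  -- the perturbation bound.
  have hgapΛ : Λ⁻¹ ≤ l - lam K := inv_le_of_inv_le₀ hgap hgap_le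
  have hΛx : Λ * (x * ((L : ℝ) ^ (3 / 2 : ℝ) * s)) ≤ x * (A * B) * κ := by
    calc Λ * (x * ((L : ℝ) ^ (3 / 2 : ℝ) * s)) ≤ Λ * (x * ((L : ℝ) ^ 2 * s)) := by gcongr
      _ = x * (Λ * (L : ℝ) ^ 2 * s) := by ring
      _ ≤ x * (A * B * κ) := by gcongr
      _ = _ := by ring
  have hδ : ‖empCov X L N ω - lagCov μ X L‖ ≤ Λ⁻¹ / 2 := by
    refine (norm_le_of_hsNorm_le (by positivity) hC).trans ?_
    rw [← mul_le_mul_iff_right₀ hΛ]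
    calc Λ * (x * ((L : ℝ) ^ (3 / 2 : ℝ) * s)) ≤ x * (A * B) * κ := hΛx
      _ ≤ 1 / 2 := by rw [mul_assoc]; exact hsmall
      _ = Λ * (Λ⁻¹ / 2) := by field_simp
  have hmu : ∀ i, 0 ≤ mu i := fun i => by
    rw [he.eq_inner i]
    exact empCov_inner_nonneg X hLN ω _
  refine (hc.hsNorm_estimator_sub_le he hmu hD hθ hK (inv_pos.2 hΛ) (hlam0 K) hgapΛ hδ).trans ?_
  refine add_le_add_left ?_ _
  have hPe : ‖rowOp ψ L‖ₑ ≤ ENNReal.ofReal P := by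
    rw [← ofReal_norm]
    exact ENNReal.ofReal_le_ofReal hψP
  calc _ ≤ (ENNReal.ofReal (y * (L * s)) + ENNReal.ofReal (σ * (√L * τ)) +
          ENNReal.ofReal P * ENNReal.ofReal (x * ((L : ℝ) ^ (3 / 2 : ℝ) * s)) +
          ENNReal.ofReal θ * ENNReal.ofReal Q) * ENNReal.ofReal (2 / l) +
        ENNReal.ofReal P * (ENNReal.ofReal (2 / Λ⁻¹) *
          ENNReal.ofReal (x * ((L : ℝ) ^ (3 / 2 : ℝ) * s))) := by gcongr
    _ = ENNReal.ofReal ((y * (L * s) + σ * (√L * τ) + P * (x * ((L : ℝ) ^ (3 / 2 : ℝ) * s)) +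
          θ * Q) * (2 / l) + P * (2 / Λ⁻¹ * (x * ((L : ℝ) ^ (3 / 2 : ℝ) * s)))) := by
        rw [← ENNReal.ofReal_mul hP, ← ENNReal.ofReal_mul hθ.le,
          ← ENNReal.ofReal_add (by positivity) (by positivity),
          ← ENNReal.ofReal_add (by positivity) (by positivity),
          ← ENNReal.ofReal_add (by positivity) (by positivity),
          ← ENNReal.ofReal_mul (by positivity), ← ENNReal.ofReal_mul (by positivity),
          ← ENNReal.ofReal_mul hP, ← ENNReal.ofReal_add (by positivity) (by positivity)]
    _ ≤ _ := by
        refine ENNReal.ofReal_le_ofReal ?_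
        -- One bound per source of error: cross-covariance, truncated tail, covariance,
        -- regularisation, eigenprojection. In `t2`, `√L` times the `L^{3/2}` of the tail condition
        -- gives `L²`.
        have t1 : y * (L * s) * l⁻¹ ≤ y * (A * B) * κ := by
          have : (L : ℝ) ≤ (L : ℝ) ^ 2 := le_self_pow₀ hL' two_ne_zero
          calc y * (L * s) * l⁻¹ ≤ y * ((L : ℝ) ^ 2 * s) * l⁻¹ := by gcongr
            _ = y * ((L : ℝ) ^ 2 * s * l⁻¹) := by ring
            _ ≤ y * (A * B * κ) := by gcongr
            _ = _ := by ring
        have t2 : σ * (√L * τ) * l⁻¹ ≤ σ * A * κ := by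
          calc σ * (√L * τ) * l⁻¹
              ≤ σ * (√L * (K * Λ * (L : ℝ) ^ (3 / 2 : ℝ) * s)) * l⁻¹ := by gcongr
            _ = σ * (K * Λ * (√L * (L : ℝ) ^ (3 / 2 : ℝ)) * s * l⁻¹) := by ring
            _ = σ * (K * Λ * (L : ℝ) ^ 2 * s * l⁻¹) := by rw [sqrt_mul_rpow_three_halves hL']
            _ ≤ σ * (A * κ) := by gcongr
            _ = _ := by ring
        have t3 : P * (x * ((L : ℝ) ^ (3 / 2 : ℝ) * s)) * l⁻¹ ≤ P * (x * (A * B)) * κ := by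
          calc P * (x * ((L : ℝ) ^ (3 / 2 : ℝ) * s)) * l⁻¹
              ≤ P * (x * ((L : ℝ) ^ 2 * s)) * l⁻¹ := by gcongr
            _ = P * (x * ((L : ℝ) ^ 2 * s * l⁻¹)) := by ring
            _ ≤ P * (x * (A * B * κ)) := by gcongr
            _ = _ := by ring
        have t4 : θ * Q * l⁻¹ ≤ A * Q * κ := by
          calc θ * Q * l⁻¹ ≤ K * Λ * (L : ℝ) ^ 2 * s * Q * l⁻¹ := by gcongr
            _ = K * Λ * (L : ℝ) ^ 2 * s * l⁻¹ * Q := by ring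
            _ ≤ A * κ * Q := by gcongr
            _ = _ := by ring
        have t5 : P * (Λ * (x * ((L : ℝ) ^ (3 / 2 : ℝ) * s))) ≤ P * (x * (A * B)) * κ := by
          rw [mul_assoc]
          gcongr
        calc _ = 2 * (y * (L * s) * l⁻¹ + σ * (√L * τ) * l⁻¹ +
              P * (x * ((L : ℝ) ^ (3 / 2 : ℝ) * s)) * l⁻¹ + θ * Q * l⁻¹ +
              P * (Λ * (x * ((L : ℝ) ^ (3 / 2 : ℝ) * s)))) := by
              rw [div_inv_eq_mul]
              ring
          _ ≤ 2 * (y * (A * B) * κ + σ * A * κ + P * (x * (A * B)) * κ + A * Q * κ +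
              P * (x * (A * B)) * κ) := by gcongr
          _ = _ := by ring

end Rates

end FMA

end

/-! ### Consistency rates for the estimated moving-average operators -/

theorem mainTheorem7
    {Ω : Type*} [MeasurableSpace Ω] (μ : Measure Ω) [IsProbabilityMeasure μ]
    {H : Type*} [NormedAddCommGroup H] [InnerProductSpace ℝ H] [CompleteSpace H]
    [TopologicalSpace.SeparableSpace H] [MeasurableSpace H] [BorelSpace H]
    -- the white noise
    (ε : ℤ → Ω → H) (hε_noise : FMA.IsWhiteNoise μ ε) (hε_stat : FMA.IsStationary μ ε)
    (hε_erg : FMA.IsErgodicProcess μ ε) (hε_L4 : ∀ k, MemLp (ε k) 4 μ)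
    (hε_inj : Function.Injective (FMA.cov μ (ε 0)))
    -- the invertible fMA(q) process
    (X : ℤ → Ω → H) (hX_L2 : ∀ k, MemLp (X k) 2 μ)
    (q : ℕ) (β : ℕ → H →L[ℝ] H) (hX_fma : FMA.IsFMA μ X ε q β)
    (ψ : ℕ → H →L[ℝ] H) (hX_inv : FMA.IsInvertible μ X ε ψ)
    (hψ_hs : ∀ i, 1 ≤ i → FMA.hsNorm (ψ i) < ∞)
    (hψ_sq : ∑' i : ℕ, FMA.hsNorm (ψ (i + 1)) ^ 2 < ∞)
    (hψ_sum : Summable fun i : ℕ => ‖ψ (i + 1)‖)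
    -- the sequence `L = L_N` and the rates of the empirical operators
    (L : ℕ → ℕ) (hL_one : ∀ N, 1 ≤ L N) (hL_top : Tendsto L atTop atTop)
    (hL : (fun N => (L N : ℝ)) =o[atTop] fun N : ℕ => (N : ℝ) ^ (1 / 3 : ℝ))
    (hC : FMA.IsBigOInProb μ
      (fun N ω => FMA.hsNorm (FMA.empCov X (L N) N ω - FMA.lagCov μ X (L N)))
      fun N => (L N : ℝ) ^ (3 / 2 : ℝ) * (N : ℝ) ^ (-(1 / 2) : ℝ))
    (hD : FMA.IsBigOInProb μ
      (fun N ω => FMA.hsNorm (FMA.empCrossCov X (L N) N ω - FMA.lagCrossCov μ X (L N)))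
      fun N => (L N : ℝ) * (N : ℝ) ^ (-(1 / 2) : ℝ))
    -- the eigenpairs of the covariance operators of `X^{[L]}` and of `X`
    (lam : ℕ → ℕ → ℝ) (c : ∀ N, HilbertBasis ℕ ℝ (FMA.Pow H (L N)))
    (hc : ∀ N, FMA.IsEigenSystem (FMA.lagCov μ X (L N)) (lam N) (c N))
    (hlam : ∀ N j, lam N j ≠ lam N (j + 1))
    (ν : ℕ → ℝ) (d : HilbertBasis ℕ ℝ H) (hd : FMA.IsEigenSystem (FMA.cov μ (X 0)) ν d)
    -- the Sobolev sums
    (b : ℝ) (hb : 0 < b) (hS : ∀ N, FMA.sobolevSum (FMA.rowOp ψ (L N)) (c N) d b < ∞)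
    -- the tuning parameters
    (K : ℕ → ℕ) (hK_one : ∀ N, 1 ≤ K N) (hK_top : Tendsto K atTop atTop)
    (θ : ℕ → ℝ) (hθ_pos : ∀ N, 0 < θ N) (hθ_zero : Tendsto θ atTop (𝓝 0))
    (hθ_lam : θ =o[atTop] fun N => lam N (K N - 1))
    (hK : (fun N => (K N : ℝ) ^ (1 + b) * (lam N (K N - 1))⁻¹ * FMA.gapSup (lam N) (K N) *
      (L N : ℝ) ^ 2) =O[atTop] fun N : ℕ => (N : ℝ) ^ (1 / 2 : ℝ))
    (hψ_tail : (fun N => ∑' i : ℕ, ‖ψ (L N + 1 + i)‖) =o[atTop] fun N =>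
      (K N : ℝ) * FMA.gapSup (lam N) (K N) * (L N : ℝ) ^ (3 / 2 : ℝ) * (N : ℝ) ^ (-(1 / 2) : ℝ))
    (hθ_rate : θ =o[atTop] fun N =>
      (K N : ℝ) * FMA.gapSup (lam N) (K N) * (L N : ℝ) ^ 2 * (N : ℝ) ^ (-(1 / 2) : ℝ))
    -- the eigenpairs of the empirical covariance operators
    (lamHat : ℕ → Ω → ℕ → ℝ) (cHat : ∀ N, Ω → HilbertBasis ℕ ℝ (FMA.Pow H (L N)))
    (hcHat : ∀ N ω, FMA.IsEigenSystem (FMA.empCov X (L N) N ω) (lamHat N ω) (cHat N ω)) :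
    (∀ j ∈ Finset.Icc 1 q, FMA.IsBigOInProb μ
      (fun N ω =>
        FMA.hsNorm (FMA.betaHat X (L N) N (K N) (θ N) (cHat N ω) ω j - β j))
      fun N => (K N : ℝ) ^ (-b) *
        √(1 + (FMA.sobolevSum (FMA.rowOp ψ (L N)) (c N) d b).toReal)) ∧
    ((∃ s < ∞, Tendsto (fun N => FMA.sobolevSum (FMA.rowOp ψ (L N)) (c N) d b) atTop (𝓝 s)) →
      ∀ j ∈ Finset.Icc 1 q, FMA.IsBigOInProb μ
        (fun N ω =>
          FMA.hsNorm (FMA.betaHat X (L N) N (K N) (θ N) (cHat N ω) ω j - β j))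
        fun N => (K N : ℝ) ^ (-b)) := by
  have hε_L2 := hε_noise.weaklyStationary.memLp
  have hX_mean := hX_inv.centered
  have hfirst : ∀ j ∈ Finset.Icc 1 q, FMA.IsBigOInProb μ
      (fun N ω => FMA.hsNorm (FMA.betaHat X (L N) N (K N) (θ N) (cHat N ω) ω j - β j))
      fun N => (K N : ℝ) ^ (-b) *
        √(1 + (FMA.sobolevSum (FMA.rowOp ψ (L N)) (c N) d b).toReal) := by
    intro j hj
    obtain ⟨hj1, hjq⟩ := Finset.mem_Icc.1 hj
    have hβj : FMA.causalOp ψ j = β j := by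
      rw [hX_inv.causalOp_eq hX_fma hε_noise hX_L2 hε_inj hψ_sum d hjq, FMA.maCoef,
        if_neg (by omega)]
    obtain ⟨Q, hQ, hψQ⟩ := FMA.exists_hsNorm_rowOp_le hψ_sq
    set P := ∑' i : ℕ, ‖ψ (i + 1)‖ with hP_def
    have hP : 0 ≤ P := tsum_nonneg fun _ => norm_nonneg _
    have hψP : ∀ n, ‖FMA.rowOp ψ n‖ ≤ P := fun n =>
      (FMA.norm_rowOp_le ψ n).trans (hψ_sum.sum_le_tsum _ fun _ _ => norm_nonneg _)
    obtain ⟨B, hB⟩ : ∃ B : ℝ, ∀ N, lam N 0 ≤ B := by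
      refine ⟨(q + 1) * ∑ j ∈ Finset.range (q + 1),
        ‖FMA.cov μ (ε 0)‖ * ‖FMA.maCoef β j‖ ^ 2 * 1 ^ 2, fun N => ?_⟩
      have h := hX_fma.inner_lagCov_le hε_noise hX_L2 hX_mean (L N) (c N 0)
      rwa [(c N).orthonormal.1 0, ← (hc N).eq_inner 0] at h
    have hlam0 : ∀ N j, 0 ≤ lam N j := fun N j => by
      rw [(hc N).eq_inner j, FMA.inner_lagCov hX_L2 hX_mean]
      exact integral_nonneg fun ω => sq_nonneg _
    have hB0 : 0 ≤ B := (hlam0 0 0).trans (hB 0)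
    obtain ⟨A, hA0, hA⟩ := hK.exists_pos
    have hgap0 : ∀ N, 0 ≤ FMA.gapSup (lam N) (K N) := fun N =>
      le_trans (inv_nonneg.2 (sub_nonneg.2 ((hc N).antitone (Nat.le_succ 0))))
        (FMA.inv_gap_le_gapSup (lam N) (hK_one N))
    set σ := (eLpNorm (X 0) 2 μ).toReal ^ 2 with hσ_def
    have hKb : Tendsto (fun N => (K N : ℝ) ^ (-b)) atTop (𝓝 0) :=
      (tendsto_rpow_neg_atTop hb).comp (tendsto_natCast_atTop_atTop.comp hK_top)
    refine hC.of_imp hD fun x y hx hy => ?_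
    set C := 2 * (y * (A * B) + σ * A + P * (x * (A * B)) + A * Q + P * (x * (A * B))) with hC_def
    have hC0 : 0 ≤ C := by positivity
    -- The radius must not depend on `N`, but the Sobolev sums may be unbounded. `C + Q` works since
    -- `K^{-b} ≤ 1` and the truncation residual never exceeds the norm of the row.
    obtain ⟨C', hC', hcausal⟩ := FMA.exists_hsNorm_causalOp_sub_le ψ
      (B := ENNReal.ofReal (C + Q)) ENNReal.ofReal_ne_top j
    -- `C + 1` adds the truncation residual to `C`; the final `+ 1` only ensures positivity.
    refine ⟨C'.toReal * (C + 1) + 1, by positivity, ?_⟩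
    have hsmall : ∀ᶠ N in atTop, x * (A * B * (K N : ℝ) ^ (-b)) ≤ 1 / 2 := by
      have h : Tendsto (fun N => x * (A * B * (K N : ℝ) ^ (-b))) atTop (𝓝 0) := by
        simpa using (hKb.const_mul (A * B)).const_mul x
      exact h.eventually_le_const (by norm_num)
    -- Once `q ≤ L_N`, the components of index up to `j` are genuine, not the default `0`.
    filter_upwards [hsmall, FMA.eventually_le_of_isLittleO hL, hL_top.eventually_ge_atTop q,
      eventually_ge_atTop 1, hA.bound, hψ_tail.bound zero_lt_one, hθ_rate.bound zero_lt_one]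
      with N hN_small hLN hqL hN hN_A hN_tail hN_θ ω hω1 hω2
    have hN0 : (0 : ℝ) < N := by exact_mod_cast hN
    have hK0 : (1 : ℝ) ≤ K N := by exact_mod_cast hK_one N
    have hs : (0 : ℝ) ≤ (N : ℝ) ^ (-(1 / 2) : ℝ) := by positivity
    have hA' : (K N : ℝ) ^ (1 + b) * (lam N (K N - 1))⁻¹ * FMA.gapSup (lam N) (K N) *
        (L N : ℝ) ^ 2 * (N : ℝ) ^ (-(1 / 2) : ℝ) ≤ A := by
      have h1 := (le_abs_self _).trans hN_A
      rw [Real.norm_of_nonneg (by positivity)] at h1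
      calc _ ≤ A * (N : ℝ) ^ (1 / 2 : ℝ) * (N : ℝ) ^ (-(1 / 2) : ℝ) := by gcongr
        _ = A := by
          rw [mul_assoc, ← Real.rpow_add hN0, add_neg_cancel, Real.rpow_zero, mul_one]
    have htail0 : 0 ≤ ∑' i : ℕ, ‖ψ (L N + 1 + i)‖ := tsum_nonneg fun _ => norm_nonneg _
    have hg := hgap0 N
    rw [one_mul, Real.norm_of_nonneg htail0, Real.norm_of_nonneg (by positivity)] at hN_tail
    rw [one_mul, Real.norm_of_nonneg (hθ_pos N).le, Real.norm_of_nonneg (by positivity)] at hN_θ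
    have herr := FMA.hsNorm_rowHat_sub_le hLN (hL_one N) (hc N) (hcHat N ω) (hlam0 N) (hlam N)
      (hX_fma.lagCrossCov_eq hX_inv hε_noise hX_L2 (L N)) (hθ_pos N) (hK_one N) (hB N) hs
      (sq_nonneg _) hP hQ htail0 hx.le hy.le hA' (hψP _) (hψQ _)
      (hX_inv.hsNorm_crossMom_invRem_le hX_L2 hε_L2 hψ_sum (c N)) hN_tail hN_θ hN_small hω1 hω2
    have hKb1 : (K N : ℝ) ^ (-b) ≤ 1 := Real.rpow_le_one_of_one_le_of_nonpos hK0 (by linarith)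
    set S := FMA.sobolevSum (FMA.rowOp ψ (L N)) (c N) d b with hS_def
    have hS1 : 1 ≤ √(1 + S.toReal) := by
      rw [Real.one_le_sqrt]
      linarith [S.toReal_nonneg]
    have hbound : FMA.hsNorm (FMA.rowHat X (L N) N (K N) (θ N) (cHat N ω) ω - FMA.rowOp ψ (L N)) ≤
        ENNReal.ofReal (C + Q) := by
      refine herr.trans ?_
      rw [ENNReal.ofReal_add hC0 hQ]
      refine add_le_add (ENNReal.ofReal_le_ofReal (mul_le_of_le_one_right hC0 hKb1)) ?_
      exact (FMA.hsNorm_sub_comp_projFirst_le _ _ _).trans (hψQ _)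
    have hrate : FMA.hsNorm (FMA.rowHat X (L N) N (K N) (θ N) (cHat N ω) ω - FMA.rowOp ψ (L N)) ≤
        ENNReal.ofReal ((C + 1) * ((K N : ℝ) ^ (-b) * √(1 + S.toReal))) := by
      refine herr.trans ?_
      rw [add_mul, one_mul, ENNReal.ofReal_add (by positivity) (by positivity)]
      refine add_le_add (ENNReal.ofReal_le_ofReal ?_)
        (FMA.hsNorm_sub_comp_projFirst_le_rate _ _ d (hK_one N) hb (hS N))
      exact mul_le_mul_of_nonneg_left (le_mul_of_one_le_right (by positivity) hS1) hC0
    have hcomp := hcausal (FMA.component (FMA.rowHat X (L N) N (K N) (θ N) (cHat N ω) ω)) _ hbound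
      (fun i hi1 hij => by
        rw [← FMA.component_rowOp ψ hi1 (by omega : i ≤ L N), ← FMA.component_sub]
        exact FMA.hsNorm_component_le _ _) j le_rfl
    rw [hβj] at hcomp
    refine hcomp.trans ((mul_le_mul_right hrate _).trans ?_)
    rw [← ENNReal.ofReal_toReal hC', ← ENNReal.ofReal_mul ENNReal.toReal_nonneg,
      ENNReal.toReal_ofReal ENNReal.toReal_nonneg, ← mul_assoc]
    refine ENNReal.ofReal_le_ofReal (mul_le_mul_of_nonneg_right ?_ (by positivity))
    linarith
  refine ⟨hfirst, ?_⟩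
  rintro ⟨s, hs, hlim⟩ j hj δ hδ
  obtain ⟨M, hM, hev⟩ := hfirst j hj δ hδ
  -- Eventually the Sobolev sums are at most `s + 1`, so the square root is absorbed in the
  -- constant.
  refine ⟨M * √(1 + (s.toReal + 1)), by positivity, ?_⟩
  have hlim' := (ENNReal.tendsto_toReal hs.ne).comp hlim
  filter_upwards [hev, hlim'.eventually_le_const (lt_add_one s.toReal)] with N hN hNs
  refine (measure_mono fun ω hω => ?_).trans hN
  refine lt_of_le_of_lt (ENNReal.ofReal_le_ofReal ?_) (Set.mem_ofPred_eq ▸ hω)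
  rw [mul_assoc, mul_comm √(1 + (s.toReal + 1))]
  have hNs' : (FMA.sobolevSum (FMA.rowOp ψ (L N)) (c N) d b).toReal ≤ s.toReal + 1 := hNs
  gcongr
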